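/- Let $q$ be an odd prime power, let $d\ge 2$, and let $V$ be a $(2d+1)$-dimensional vector space over $\mathbb F_q$ with a nondegenerate quadratic form $\kappa$ and associated bilinear form $\beta(u,v)=\kappa(u+v)-\kappa(u)-\kappa(v)$. Let $\mathcal Q(2d,q)$ be the incidence structure whose points are the totally singular $1$-spaces of $V$ and whose maximals are the totally singular subspaces of largest dimension, incidence being inclusion. A \emph{hemisystem} is a set $H$ of maximals such that every point lies on exactly $(t+1)/2$ elements of $H$, where $t+1$ is the (constant) number of maximals on a point; that is, exactly half of the maximals on each point belong to $H$. A hemisystem $H$ \emph{admits} a group $G$ if $G$ is isomorphic to a subgroup of the stabiliser of $H$ in the automorphism group of the incidence structure $\mathcal Q(2d,q)$. For a quadratic space $X$, $\Omega(X)$ denotes the derived subgroup of the orthogonal group $\mathrm O(X)$. There exist vectors $z,e,f\in V$ such that $\kappa(z)\ne 0$, $\kappa(e)=\kappa(f)=0$, $\beta(e,f)=1$, $\beta(z,e)=\beta(z,f)=0$, and such that $U=W^\perp$ is of elliptic type, where $W=\langle z,e,f\rangle$ (that is, $\kappa|_U$ is nondegenerate of Witt index $\tfrac12\dim U-1=d-2$).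 For every such triple put \[ B=\{g\oplus 1_{U} : g\in\Omega(W,\kappa|_W)\}\le \mathrm O(V),\qquad A=\langle B,\tau\rangle , \] where $\tau\in\mathrm O(V)$ is the reflection with $\tau(z)=-z$ that fixes $z^\perp$ pointwise. Then: 1. $B\cong\Omega(W,\kappa|_W)=\Omega_3(q)$ and $B\cong\mathrm{PSL}_2(q)$; 2. $A$ and $B$ have the same orbits on points; 3. each $A$-orbit on maximals is the union of two distinct $B$-orbits; 4. if $n$ is the number of orbits of $A$ on the maximals, then there exist $2^n$ distinct hemisystems of $\mathcal Q(2d,q)$ that are invariant under $B$ and admit $B\cong\Omega_3(q)\cong\mathrm{PSL}_2(q)$. -/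

import Mathlib

/-! ### Incidence structures, hemisystems and automorphisms -/

section Incidence

variable {P M : Type*}

/-- Order `(s, t)`: `s + 1` points on every maximal and `t + 1` maximals on every point. -/
def HasOrder (I : P → M → Prop) (s t : ℕ) : Prop :=
  (∀ m, Nat.card {p // I p m} = s + 1) ∧ ∀ p, Nat.card {m // I p m} = t + 1

/-- A hemisystem of an incidence structure of order `(s, t)`: every point is incident with
exactly `(t + 1) / 2` maximals of `H`. -/
def IsHemisystem (I : P → M → Prop) (H : Set M) : Prop :=
  ∃ s t, HasOrder I s t ∧ ∀ p, 2 * Nat.card {m // m ∈ H ∧ I p m} = t + 1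

/-- The automorphism group of an incidence structure. -/
def incidenceAut (I : P → M → Prop) : Subgroup (Equiv.Perm P × Equiv.Perm M) where
  carrier := {g | ∀ p m, I (g.1 p) (g.2 m) ↔ I p m}
  one_mem' := by intro p m; rfl
  mul_mem' := by
    intro a b ha hb p m
    exact (ha _ _).trans (hb _ _)
  inv_mem' := by
    intro a ha p m
    have := ha (a.1⁻¹ p) (a.2⁻¹ m)
    simpa using this.symm

/-- The stabiliser of a set `H` of maximals in the automorphism group. -/
def incidenceStab (I : P → M → Prop) (H : Set M) : Subgroup (incidenceAut I) where
  carrier := {g | ∀ m, g.1.2 m ∈ H ↔ m ∈ H}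
  one_mem' := by intro m; rfl
  mul_mem' := by
    intro a b ha hb m
    exact (ha _).trans (hb _)
  inv_mem' := by
    intro a ha m
    have := ha (a.1.2⁻¹ m)
    simpa using this.symm

/-- `H` admits the group `G`: `G` is isomorphic to a subgroup of the stabiliser of `H` in the
automorphism group. -/
def Admits (I : P → M → Prop) (H : Set M) (G : Type*) [Group G] : Prop :=
  ∃ K : Subgroup (incidenceAut I), K ≤ incidenceStab I H ∧ Nonempty (G ≃* K)

end Incidence

/-! ### Quadratic forms and quadrics -/

section Quadric

variable {F V : Type*} [Field F] [AddCommGroup V] [Module F V]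

/-- Nondegenerate: the associated bilinear form `Q (u + v) - Q u - Q v` is nondegenerate. -/
def IsNondegenerate (Q : QuadraticForm F V) : Prop :=
  ∀ v, (∀ u, QuadraticMap.polar Q u v = 0) → v = 0

def IsTotallySingular (Q : QuadraticForm F V) (N : Submodule F V) : Prop :=
  ∀ v ∈ N, Q v = 0

/-- The largest dimension of a totally singular subspace. -/
noncomputable def wittIndex (Q : QuadraticForm F V) : ℕ :=
  sSup {k | ∃ N : Submodule F V, IsTotallySingular Q N ∧ Module.finrank F N = k}

/-- Elliptic type: nondegenerate, of even dimension `2m`, with Witt index `m - 1`. -/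
def IsElliptic (Q : QuadraticForm F V) : Prop :=
  IsNondegenerate Q ∧ Module.finrank F V = 2 * (wittIndex Q + 1)

/-- The restriction of a quadratic form to a subspace. -/
def restrictForm (Q : QuadraticForm F V) (W : Submodule F V) : QuadraticForm F W :=
  Q.comp W.subtype

/-- The perp of a subspace with respect to the associated bilinear form. -/
def perp (Q : QuadraticForm F V) (W : Submodule F V) : Submodule F V where
  carrier := {v | ∀ w ∈ W, QuadraticMap.polar Q w v = 0}
  zero_mem' := by intro w _; simp
  add_mem' := by
    intro a b ha hb w hw
    rw [QuadraticMap.polar_add_right, ha w hw, hb w hw, add_zero]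
  smul_mem' := by
    intro c a ha w hw
    rw [QuadraticMap.polar_smul_right, ha w hw, smul_zero]

/-- The points of the quadric: totally singular subspaces of dimension one. -/
def QPoint (Q : QuadraticForm F V) : Type _ :=
  {N : Submodule F V // IsTotallySingular Q N ∧ Module.finrank F N = 1}

/-- The maximals of the quadric: totally singular subspaces of the largest dimension. -/
def QMaximal (Q : QuadraticForm F V) : Type _ :=
  {N : Submodule F V // IsTotallySingular Q N ∧ Module.finrank F N = wittIndex Q}

/-- Incidence of points and maximals is inclusion. -/
def qIncident (Q : QuadraticForm F V) (p : QPoint Q) (m : QMaximal Q) : Prop :=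
  p.1 ≤ m.1

/-! ### Orthogonal groups and their action on the quadric -/

/-- The orthogonal group `O(V)`. -/
def orthGroup (Q : QuadraticForm F V) : Subgroup (V ≃ₗ[F] V) where
  carrier := {g | ∀ v, Q (g v) = Q v}
  one_mem' := by intro v; rfl
  mul_mem' := by
    intro a b ha hb v
    exact (ha _).trans (hb _)
  inv_mem' := by
    intro a ha v
    have h := ha (a⁻¹ v)
    have h2 : a (a⁻¹ v) = v := a.apply_symm_apply v
    rw [h2] at h
    exact h.symm

/-- `Ω(V)`, the derived subgroup of `O(V)`. -/
def omegaGroup (Q : QuadraticForm F V) : Subgroup (orthGroup Q) :=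
  commutator (orthGroup Q)

theorem orthGroup_map_singular (Q : QuadraticForm F V) (g : orthGroup Q) {N : Submodule F V}
    (hN : IsTotallySingular Q N) : IsTotallySingular Q (N.map (g.1 : V →ₗ[F] V)) := by
  rintro _ ⟨v, hv, rfl⟩
  exact (g.2 v).trans (hN v hv)

theorem orthGroup_map_one (Q : QuadraticForm F V) (N : Submodule F V) :
    N.map (((1 : orthGroup Q).1 : V ≃ₗ[F] V) : V →ₗ[F] V) = N :=
  Submodule.map_id N

theorem orthGroup_map_mul (Q : QuadraticForm F V) (a b : orthGroup Q) (N : Submodule F V) :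
    N.map (((a * b).1 : V ≃ₗ[F] V) : V →ₗ[F] V) =
      (N.map (b.1 : V →ₗ[F] V)).map (a.1 : V →ₗ[F] V) :=
  Submodule.map_comp (b.1 : V →ₗ[F] V) (a.1 : V →ₗ[F] V) N

instance qPointAction (Q : QuadraticForm F V) : MulAction (orthGroup Q) (QPoint Q) where
  smul g p := ⟨p.1.map (g.1 : V →ₗ[F] V), orthGroup_map_singular Q g p.2.1,
    (LinearEquiv.finrank_map_eq g.1 p.1).trans p.2.2⟩
  one_smul p := Subtype.ext (orthGroup_map_one Q p.1)
  mul_smul a b p := Subtype.ext (orthGroup_map_mul Q a b p.1)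

instance qMaximalAction (Q : QuadraticForm F V) : MulAction (orthGroup Q) (QMaximal Q) where
  smul g m := ⟨m.1.map (g.1 : V →ₗ[F] V), orthGroup_map_singular Q g m.2.1,
    (LinearEquiv.finrank_map_eq g.1 m.1).trans m.2.2⟩
  one_smul m := Subtype.ext (orthGroup_map_one Q m.1)
  mul_smul a b m := Subtype.ext (orthGroup_map_mul Q a b m.1)

/-- `Ω(W) = {g ⊕ 1 on the perp of W : g ∈ Ω of the form restricted to W}`, inside `O(V)`. -/
def omegaOn (Q : QuadraticForm F V) (W : Submodule F V) : Subgroup (orthGroup Q) where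
  carrier := {h | ∃ g ∈ omegaGroup (restrictForm Q W),
    (∀ w : W, h.1 (w : V) = ((g.1 w : W) : V)) ∧ ∀ u ∈ perp Q W, h.1 u = u}
  one_mem' := ⟨1, one_mem _, fun _ => rfl, fun _ _ => rfl⟩
  mul_mem' := by
    rintro a b ⟨g, hg, hgw, hgu⟩ ⟨k, hk, hkw, hku⟩
    refine ⟨g * k, mul_mem hg hk, fun w => ?_, fun u hu => ?_⟩
    · change a.1 (b.1 (w : V)) = ((g.1 (k.1 w) : W) : V)
      rw [hkw, hgw]
    · change a.1 (b.1 u) = u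
      rw [hku u hu, hgu u hu]
  inv_mem' := by
    rintro a ⟨g, hg, hgw, hgu⟩
    refine ⟨g⁻¹, inv_mem hg, fun w => ?_, fun u hu => ?_⟩
    · change a.1.symm (w : V) = ((g.1.symm w : W) : V)
      rw [LinearEquiv.symm_apply_eq, hgw, LinearEquiv.apply_symm_apply]
    · change a.1.symm u = u
      rw [LinearEquiv.symm_apply_eq, hgu u hu]

/-- The reflection `v ↦ v - (β(z, v) / Q z) z`: it negates `z` and fixes the perp of `z`. -/
noncomputable def reflectionIn (Q : QuadraticForm F V) (z : V) (hz : Q z ≠ 0) : orthGroup Q :=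
  ⟨Module.reflection (x := z) (f := (Q z)⁻¹ • Q.polarBilin z) (by
      rw [LinearMap.smul_apply, QuadraticMap.polarBilin_apply_apply, QuadraticMap.polar_self,
        smul_eq_mul, two_nsmul]
      field_simp
      norm_num), by
    intro v
    rw [Module.reflection_apply, sub_eq_add_neg, ← neg_smul, QuadraticMap.map_add Q,
      QuadraticMap.map_smul, QuadraticMap.polar_smul_right, QuadraticMap.polar_comm Q v z,
      LinearMap.smul_apply, QuadraticMap.polarBilin_apply_apply]
    simp only [smul_eq_mul]
    field_simp
    ring⟩

/-- `W = ⟨z, e, f⟩`. -/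
def frameSpace (F : Type*) {V : Type*} [Field F] [AddCommGroup V] [Module F V] (z e f : V) :
    Submodule F V :=
  Submodule.span F {z, e, f}

/-- `z` is nonsingular, `(e, f)` is a hyperbolic pair orthogonal to `z`, and the perp of the
subspace `⟨z, e, f⟩` is of elliptic type. -/
structure IsFrame (Q : QuadraticForm F V) (z e f : V) : Prop where
  nonsingular : Q z ≠ 0
  e_singular : Q e = 0
  f_singular : Q f = 0
  hyperbolic : QuadraticMap.polar Q e f = 1
  orth_e : QuadraticMap.polar Q z e = 0
  orth_f : QuadraticMap.polar Q z f = 0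
  elliptic : IsElliptic (restrictForm Q (perp Q (frameSpace F z e f)))

/-- `B = Ω(W)` for `W = ⟨z, e, f⟩`. -/
def groupB (Q : QuadraticForm F V) (z e f : V) : Subgroup (orthGroup Q) :=
  omegaOn Q (frameSpace F z e f)

/-- `A = ⟨B, τ⟩`, with `τ` the reflection in `z`. -/
noncomputable def groupA (Q : QuadraticForm F V) (z e f : V) (hz : Q z ≠ 0) :
    Subgroup (orthGroup Q) :=
  Subgroup.closure (insert (reflectionIn Q z hz) (groupB Q z e f : Set (orthGroup Q)))

end Quadric

/-!
`W = ⟨z, e, f⟩` is similar to the space of traceless `2 × 2` matrices with the determinant, on which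
`SL₂(q)` acts by conjugation; this action has image `Ω₃(q)` and kernel `{1, -1}`. It is transitive
enough that for every vector `v` some element of `B` agrees with `τ` at `v`, so `A` and `B` have the
same orbits on points.

Suppose that an element of `τB` fixes a maximal `m`. Then it acts on the projection `P` of `m` to
`W` as the identity modulo `L = m ∩ W`, the radical of `P`. On traceless matrices this forces
`L = 0` and `P` to be a hyperbolic line. But `m` has dimension `d` and `U = W^⊥` has Witt index
`d - 2`, so `m ∩ U` is maximal totally singular in `U`, and a singular vector of `P` would
provide a singular vector of `U` extending `m ∩ U`.

So `τB` fixes no maximal, `A` has index two over `B` and each of its orbits on maximals splits into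
two `B`-orbits interchanged by `τ`. Choosing one from each pair gives `2 ^ n` sets of maximals, and
they are hemisystems: at each point `p`, some element of `τB` fixes `p` and maps the chosen maximals
on `p` to the others.
-/

/-! ### Isometries and similitudes -/

section Isometries

open QuadraticMap

variable {F V V' : Type*} [Field F] [AddCommGroup V] [Module F V] [AddCommGroup V'] [Module F V']
  {Q : QuadraticForm F V} {Q' : QuadraticForm F V'}

theorem polar_self_eq_two_mul (Q : QuadraticForm F V) (v : V) : polar Q v v = 2 * Q v := by
  rw [polar_self, nsmul_eq_mul, Nat.cast_ofNat]

theorem polar_self_eq_zero {v : V} (hv : Q v = 0) : polar Q v v = 0 := by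
  rw [polar_self, hv, smul_zero]

theorem orthGroup_ext {g k : orthGroup Q} (h : ∀ v, g.1 v = k.1 v) : g = k :=
  Subtype.ext (LinearEquiv.ext h)

theorem orthGroup_mul_apply (g k : orthGroup Q) (v : V) : (g * k).1 v = g.1 (k.1 v) := rfl

theorem orthGroup_polar (g : orthGroup Q) (u v : V) : polar Q (g.1 u) (g.1 v) = polar Q u v := by
  rw [polar, polar, ← map_add, g.2, g.2, g.2]

/-- The isometry `v ↦ -v`. -/
def negIsometry (Q : QuadraticForm F V) : orthGroup Q :=
  ⟨LinearEquiv.neg F, fun v => by rw [LinearEquiv.neg_apply, QuadraticMap.map_neg]⟩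

theorem negIsometry_apply (v : V) : (negIsometry Q).1 v = -v := rfl

theorem negIsometry_mem_center : negIsometry Q ∈ Subgroup.center (orthGroup Q) :=
  Subgroup.mem_center_iff.2 fun g => orthGroup_ext fun v => map_neg g.1 v

theorem negIsometry_mul_self : negIsometry Q * negIsometry Q = 1 :=
  orthGroup_ext fun v => neg_neg v

theorem reflectionIn_apply {z : V} (hz : Q z ≠ 0) (v : V) :
    (reflectionIn Q z hz).1 v = v - ((Q z)⁻¹ * polar Q z v) • z := rfl

theorem reflectionIn_apply_of_polar_eq_zero {z : V} (hz : Q z ≠ 0) {v : V}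
    (hv : polar Q z v = 0) : (reflectionIn Q z hz).1 v = v := by
  rw [reflectionIn_apply, hv, mul_zero, zero_smul, sub_zero]

theorem reflectionIn_mul_self {z : V} (hz : Q z ≠ 0) :
    reflectionIn Q z hz * reflectionIn Q z hz = 1 :=
  orthGroup_ext fun v => Module.involutive_reflection (by
    rw [LinearMap.smul_apply, polarBilin_apply_apply, polar_self_eq_two_mul, smul_eq_mul,
      mul_left_comm, inv_mul_cancel₀ hz, mul_one]) v

theorem reflectionIn_sub_apply {x y : V} (hxy : Q x = Q y) (h : Q (x - y) ≠ 0) :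
    (reflectionIn Q (x - y) h).1 x = y := by
  have hpolar : polar Q (x - y) x = Q (x - y) := by
    rw [polar_sub_left, polar_self_eq_two_mul, sub_eq_add_neg x y, QuadraticMap.map_add Q,
      QuadraticMap.map_neg, polar_neg_right, ← hxy, polar_comm Q y x]
    ring
  rw [reflectionIn_apply, hpolar, inv_mul_cancel₀ h, one_smul, sub_sub_cancel]

theorem exists_mem_apply_eq_of_reflectionIn_mem (h2 : (2 : F) ≠ 0) {K : Subgroup (orthGroup Q)}
    (hneg : negIsometry Q ∈ K) (hrefl : ∀ x (hx : Q x ≠ 0), reflectionIn Q x hx ∈ K)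
    {x y : V} (hx : Q x ≠ 0) (hxy : Q x = Q y) : ∃ k ∈ K, k.1 x = y := by
  by_cases hsub : Q (x - y) = 0
  · -- `Q (x - y) + Q (x + y) = 4 Q x`
    have hadd : Q (x - -y) ≠ 0 := by
      intro h
      rw [sub_eq_add_neg, QuadraticMap.map_add Q, polar_neg_right, QuadraticMap.map_neg] at hsub
      rw [sub_neg_eq_add, QuadraticMap.map_add Q] at h
      refine mul_ne_zero (mul_ne_zero h2 h2) hx ?_
      linear_combination hsub + h + 2 * hxy
    refine ⟨negIsometry Q * reflectionIn Q (x - -y) hadd, mul_mem hneg (hrefl _ _), ?_⟩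
    rw [orthGroup_mul_apply, reflectionIn_sub_apply (by rw [QuadraticMap.map_neg, hxy]),
      negIsometry_apply, neg_neg]
  · exact ⟨reflectionIn Q (x - y) hsub, hrefl _ _, reflectionIn_sub_apply hxy hsub⟩

/-- Conjugation by a similitude `φ` with multiplier `c`, as an isomorphism of orthogonal groups. -/
def orthGroupCongr (φ : V ≃ₗ[F] V') {c : F} (hc : c ≠ 0) (hφ : ∀ v, Q' (φ v) = c * Q v) :
    orthGroup Q ≃* orthGroup Q' where
  toFun g := ⟨(φ.symm.trans g.1).trans φ, fun v => by
    change Q' (φ (g.1 (φ.symm v))) = Q' v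
    rw [hφ, g.2, ← hφ, φ.apply_symm_apply]⟩
  invFun g := ⟨(φ.trans g.1).trans φ.symm, fun v => by
    change Q (φ.symm (g.1 (φ v))) = Q v
    apply mul_left_cancel₀ hc
    rw [← hφ, ← hφ, φ.apply_symm_apply, g.2]⟩
  left_inv g := orthGroup_ext fun v => by simp
  right_inv g := orthGroup_ext fun v => by simp
  map_mul' g k := orthGroup_ext fun v => by simp

variable {φ : V ≃ₗ[F] V'} {c : F}

theorem orthGroupCongr_apply (hc : c ≠ 0) (hφ : ∀ v, Q' (φ v) = c * Q v) (g : orthGroup Q)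
    (v : V) : (orthGroupCongr φ hc hφ g).1 (φ v) = φ (g.1 v) := by
  simp [orthGroupCongr]

theorem map_omegaGroup_orthGroupCongr (hc : c ≠ 0) (hφ : ∀ v, Q' (φ v) = c * Q v) :
    (omegaGroup Q).map (orthGroupCongr φ hc hφ).toMonoidHom = omegaGroup Q' := by
  rw [omegaGroup, omegaGroup, commutator_def, commutator_def, Subgroup.map_commutator,
    Subgroup.map_top_of_surjective _ (orthGroupCongr φ hc hφ).surjective]

theorem polar_similitude (hφ : ∀ v, Q' (φ v) = c * Q v) (u v : V) :
    polar Q' (φ u) (φ v) = c * polar Q u v := by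
  rw [polar, polar, ← map_add, hφ, hφ, hφ]
  ring

theorem orthGroupCongr_reflectionIn (hc : c ≠ 0) (hφ : ∀ v, Q' (φ v) = c * Q v) {z : V}
    (hz : Q z ≠ 0) (hz' : Q' (φ z) ≠ 0) :
    orthGroupCongr φ hc hφ (reflectionIn Q z hz) = reflectionIn Q' (φ z) hz' := by
  refine orthGroup_ext fun v => ?_
  obtain ⟨v, rfl⟩ := φ.surjective v
  rw [orthGroupCongr_apply, reflectionIn_apply, reflectionIn_apply, map_sub, map_smul,
    polar_similitude hφ, hφ]
  congr 2
  field_simp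

end Isometries

section Commutators

open Matrix
open scoped MatrixGroups commutatorElement

theorem commutatorElement_mul_left_of_mem_center {G : Type*} [Group G] {m : G}
    (hm : m ∈ Subgroup.center G) (a b : G) : ⁅m * a, b⁆ = ⁅a, b⁆ := by
  rw [commutatorElement_mul_left_eq_conj_mul,
    Commute.commutator_eq (Subgroup.mem_center_iff.1 hm b).symm, mul_one,
    ← Subgroup.mem_center_iff.1 hm, mul_inv_cancel_right]

theorem commutator_eq_of_center_sup_eq_top {G : Type*} [Group G] {H : Subgroup G}
    (hH : Subgroup.center G ⊔ H = ⊤) : commutator G = ⁅H, H⁆ := by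
  have hG : ∀ g : G, ∃ m ∈ Subgroup.center G, ∃ h ∈ H, m * h = g := fun g =>
    Subgroup.mem_sup_of_normal_left.1 (hH ▸ Subgroup.mem_top g)
  refine le_antisymm (Subgroup.commutator_le.2 fun g _ k _ => ?_)
    (Subgroup.commutator_mono le_top le_top)
  obtain ⟨m, hm, g, hg, rfl⟩ := hG g
  obtain ⟨n, hn, k, hk, rfl⟩ := hG k
  rw [commutatorElement_mul_left_of_mem_center hm, ← commutatorElement_inv,
    commutatorElement_mul_left_of_mem_center hn, commutatorElement_inv]
  exact Subgroup.commutator_mem_commutator hg hk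

variable {F : Type*} [Field F]

theorem toGL_transvection_mem_commutator (h2 : (2 : F) ≠ 0) {i j : Fin 2} (hij : i ≠ j) (c : F) :
    SpecialLinearGroup.toGL (SpecialLinearGroup.transvection hij c) ∈
      commutator (GL (Fin 2) F) := by
  have hdet : (diagonal (fun l => if l = i then (-1 : F) else 1)).det ≠ 0 := by
    rw [det_diagonal, Fin.prod_univ_two]
    split_ifs <;> simp
  have hcomm : SpecialLinearGroup.toGL (SpecialLinearGroup.transvection hij c) =
      ⁅GeneralLinearGroup.mkOfDetNeZero _ hdet, SpecialLinearGroup.toGL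
        (SpecialLinearGroup.transvection hij (-c / 2))⁆ := by
    rw [commutatorElement_def, eq_mul_inv_iff_mul_eq, eq_mul_inv_iff_mul_eq]
    refine Units.ext ?_
    simp only [Units.val_mul, GeneralLinearGroup.mkOfDetNeZero,
      SpecialLinearGroup.coe_GL_coe_matrix, SpecialLinearGroup.transvection_coe]
    ext a b
    fin_cases i <;> fin_cases j <;> first | exact absurd rfl hij | skip
    all_goals
      fin_cases a <;> fin_cases b <;> simp [mul_apply, Fin.sum_univ_two]
    all_goals
      field_simp
      ring
  rw [hcomm]
  exact Subgroup.commutator_mem_commutator (Subgroup.mem_top _) (Subgroup.mem_top _)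

theorem commutator_GL_two (h2 : (2 : F) ≠ 0) :
    commutator (GL (Fin 2) F) = (SpecialLinearGroup.toGL (n := Fin 2) (R := F)).range := by
  apply le_antisymm
  · refine Subgroup.commutator_le.2 fun h _ k _ => ?_
    have hdet : GeneralLinearGroup.det ⁅h, k⁆ = 1 := by
      rw [map_commutatorElement, commutatorElement_eq_one_iff_mul_comm, mul_comm]
    exact ⟨⟨(⁅h, k⁆ : GL (Fin 2) F).1, congrArg Units.val hdet⟩, Units.ext rfl⟩
  · rintro _ ⟨s, rfl⟩
    induction s using SL2.transvection_induction with
    | htransvec i j hij c => exact toGL_transvection_mem_commutator h2 hij c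
    | hmul A B hA hB => rw [map_mul]; exact mul_mem hA hB

end Commutators

/-! ### Traceless `2 × 2` matrices -/

section Traceless

open Matrix QuadraticMap
open scoped MatrixGroups commutatorElement

/-- The space of traceless `2 × 2` matrices, the model of the three-dimensional quadratic space:
`GL₂` acts on it by conjugation, preserving the determinant. -/
abbrev Traceless (F : Type*) [Field F] : Submodule F (Matrix (Fin 2) (Fin 2) F) :=
  LinearMap.ker (traceLinearMap (Fin 2) F F)

variable {F : Type*} [Field F]

theorem mem_traceless_iff {M : Matrix (Fin 2) (Fin 2) F} : M ∈ Traceless F ↔ M.trace = 0 := by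
  rw [LinearMap.mem_ker, traceLinearMap_apply]

theorem exists_mem_not_mem_span_singleton {V : Type*} [AddCommGroup V] [Module F V]
    {P : Submodule F V} (hP : 2 ≤ Module.finrank F P) (w : V) :
    ∃ x ∈ P, x ∉ Submodule.span F {w} := by
  refine SetLike.not_le_iff_exists.1 fun hle => ?_
  have := Submodule.finrank_mono hle
  have := finrank_span_le_card (R := F) ({w} : Set V)
  simp only [Set.toFinset_singleton, Finset.card_singleton] at this
  omega

namespace Traceless

/-- The traceless matrix with first row `(a, b)` and lower left entry `c`. -/
def mk (a b c : F) : Traceless F :=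
  ⟨!![a, b; c, -a], by simp [trace_fin_two]⟩

theorem coe_mk (a b c : F) : (mk a b c).1 = !![a, b; c, -a] := rfl

theorem exists_eq_mk (M : Traceless F) : ∃ a b c, M = mk a b c := by
  refine ⟨M.1 0 0, M.1 0 1, M.1 1 0, Subtype.ext ?_⟩
  have h11 : M.1 1 1 = -M.1 0 0 := by
    rw [eq_neg_iff_add_eq_zero, add_comm, ← trace_fin_two, mem_traceless_iff.1 M.2]
  rw [coe_mk, ← h11]
  exact eta_fin_two M.1

theorem mk_eq_zero {a b c : F} : mk a b c = 0 ↔ a = 0 ∧ b = 0 ∧ c = 0 := by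
  rw [← Subtype.coe_inj, coe_mk, Submodule.coe_zero, ← Matrix.ext_iff]
  simp +contextual [Fin.forall_fin_two, and_assoc]

theorem mk_add_mk (a b c a' b' c' : F) :
    mk a b c + mk a' b' c' = mk (a + a') (b + b') (c + c') := by
  refine Subtype.ext ?_
  simp [coe_mk, add_comm]

theorem smul_mk (t a b c : F) : t • mk a b c = mk (t * a) (t * b) (t * c) := by
  refine Subtype.ext ?_
  simp [coe_mk]

theorem finrank_traceless : Module.finrank F (Traceless F) = 3 := by
  have htrace : traceLinearMap (Fin 2) F F ≠ 0 := fun h => by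
    simpa [trace_fin_two] using LinearMap.congr_fun h !![1, 0; 0, 0]
  have hker := Module.Dual.finrank_ker_add_one_of_ne_zero (f := traceLinearMap (Fin 2) F F) htrace
  rw [Module.finrank_matrix, Fintype.card_fin, Module.finrank_self] at hker
  exact Nat.succ_injective hker

/-- The determinant as a quadratic form on the traceless matrices. -/
def detForm (F : Type*) [Field F] : QuadraticForm F (Traceless F) :=
  (linMulLin (entryLinearMap F F (0 : Fin 2) (0 : Fin 2)) (entryLinearMap F F 1 1) -
    linMulLin (entryLinearMap F F 0 1) (entryLinearMap F F 1 0)).comp (Traceless F).subtype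

theorem detForm_apply (M : Traceless F) : detForm F M = M.1.det := by
  simp [detForm, det_fin_two]

theorem detForm_mk (a b c : F) : detForm F (mk a b c) = -(a ^ 2 + b * c) := by
  rw [detForm_apply, coe_mk, det_fin_two_of]
  ring

theorem polar_mk (a b c a' b' c' : F) :
    polar (detForm F) (mk a b c) (mk a' b' c') = -(2 * a * a' + b * c' + c * b') := by
  rw [polar, mk_add_mk, detForm_mk, detForm_mk, detForm_mk]
  ring

theorem mul_add_mul (h : Matrix (Fin 2) (Fin 2) F) (M : Traceless F) :
    h * M.1 + M.1 * h = h.trace • M.1 + (h * M.1).trace • (1 : Matrix (Fin 2) (Fin 2) F) := by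
  obtain ⟨a, b, c, rfl⟩ := exists_eq_mk M
  rw [coe_mk, eta_fin_two h]
  simp only [mul_fin_two, trace_fin_two_of, one_fin_two, smul_of, smul_cons, smul_empty,
    smul_eq_mul, of_add_of, cons_add_cons, empty_add_empty]
  congr! 3 <;> ring_nf

theorem coe_mul_coe_add (M N : Traceless F) :
    M.1 * N.1 + N.1 * M.1 = -polar (detForm F) M N • (1 : Matrix (Fin 2) (Fin 2) F) := by
  rw [mul_add_mul, mem_traceless_iff.1 M.2, zero_smul, zero_add]
  obtain ⟨a, b, c, rfl⟩ := exists_eq_mk M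
  obtain ⟨a', b', c', rfl⟩ := exists_eq_mk N
  rw [polar_mk, coe_mk, coe_mk, mul_fin_two, trace_fin_two_of]
  ring_nf

theorem coe_mul_coe_self (M : Traceless F) :
    M.1 * M.1 = -detForm F M • (1 : Matrix (Fin 2) (Fin 2) F) := by
  obtain ⟨a, b, c, rfl⟩ := exists_eq_mk M
  rw [detForm_mk, coe_mk, mul_fin_two, one_fin_two]
  simp only [smul_of, smul_cons, smul_empty, smul_eq_mul]
  congr! 3 <;> ring_nf

/-- `M ↦ h M h⁻¹` on traceless matrices. -/
def conjLinear (h : GL (Fin 2) F) : Traceless F →ₗ[F] Traceless F where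
  toFun M := ⟨h.1 * M.1 * h⁻¹.1, by
    rw [mem_traceless_iff, trace_units_conj, mem_traceless_iff.1 M.2]⟩
  map_add' M N := by
    apply Subtype.ext
    simp [mul_add, add_mul]
  map_smul' c M := by
    apply Subtype.ext
    simp

theorem conjLinear_mul (h k : GL (Fin 2) F) (M : Traceless F) :
    conjLinear (h * k) M = conjLinear h (conjLinear k M) :=
  Subtype.ext <| by simp only [conjLinear, LinearMap.coe_mk, AddHom.coe_mk, _root_.mul_inv_rev,
    Units.val_mul, mul_assoc]

theorem conjLinear_one (M : Traceless F) : conjLinear 1 M = M :=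
  Subtype.ext <| by simp [conjLinear]

/-- The conjugation action of `GL₂` on traceless matrices, by isometries of the determinant. -/
def conjOrth (F : Type*) [Field F] : GL (Fin 2) F →* orthGroup (detForm F) where
  toFun h := ⟨LinearEquiv.ofLinearMap (conjLinear h) (conjLinear h⁻¹)
      (LinearMap.ext fun M => by
        rw [LinearMap.comp_apply, ← conjLinear_mul, mul_inv_cancel, conjLinear_one,
          LinearMap.id_apply])
      (LinearMap.ext fun M => by
        rw [LinearMap.comp_apply, ← conjLinear_mul, inv_mul_cancel, conjLinear_one,
          LinearMap.id_apply]), fun M => by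
    rw [detForm_apply, detForm_apply]
    exact det_units_conj h M.1⟩
  map_one' := orthGroup_ext fun M => conjLinear_one M
  map_mul' h k := orthGroup_ext fun M => by
    rw [orthGroup_mul_apply]
    exact conjLinear_mul h k M

theorem conjOrth_apply_eq_iff {h : GL (Fin 2) F} {M N : Traceless F} :
    (conjOrth F h).1 M = N ↔ h.1 * M.1 = N.1 * h.1 := by
  rw [← Subtype.coe_inj]
  exact Units.mul_inv_eq_iff_eq_mul h

theorem conjOrth_eq_iff {h : GL (Fin 2) F} {g : orthGroup (detForm F)} :
    conjOrth F h = g ↔ ∀ M : Traceless F, h.1 * M.1 = (g.1 M).1 * h.1 :=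
  ⟨fun e _ => conjOrth_apply_eq_iff.1 (e ▸ rfl),
    fun e => orthGroup_ext fun M => conjOrth_apply_eq_iff.2 (e M)⟩

/-- A nonsingular traceless matrix, as an element of `GL₂`. -/
noncomputable def toGL (x : Traceless F) (hx : detForm F x ≠ 0) : GL (Fin 2) F :=
  GeneralLinearGroup.mkOfDetNeZero x.1 (detForm_apply x ▸ hx)

theorem coe_toGL (x : Traceless F) (hx : detForm F x ≠ 0) : (toGL x hx).1 = x.1 := rfl

theorem reflectionIn_eq_negIsometry_mul_conjOrth {x : Traceless F} (hx : detForm F x ≠ 0) :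
    reflectionIn (detForm F) x hx = negIsometry (detForm F) * conjOrth F (toGL x hx) := by
  refine eq_mul_of_inv_mul_eq (Eq.symm ?_)
  rw [inv_eq_of_mul_eq_one_left negIsometry_mul_self, conjOrth_eq_iff]
  intro M
  rw [orthGroup_mul_apply, negIsometry_apply, reflectionIn_apply, coe_toGL, neg_sub,
    Submodule.coe_sub, Submodule.coe_smul, sub_mul, smul_mul_assoc, coe_mul_coe_self, smul_smul,
    eq_sub_iff_add_eq, coe_mul_coe_add]
  congr 1
  field_simp

theorem mem_range_conjOrth_of_apply_eq (h2 : (2 : F) ≠ 0) {g : orthGroup (detForm F)} {b : F}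
    (hz : g.1 (mk 1 0 0) = mk 1 0 0) (he : g.1 (mk 0 1 0) = mk 0 b 0) :
    g ∈ (conjOrth F).range := by
  obtain ⟨r, s, c, hf⟩ := exists_eq_mk (g.1 (mk 0 0 1))
  have hzf := orthGroup_polar g (mk 1 0 0) (mk 0 0 1)
  have hef := orthGroup_polar g (mk 0 1 0) (mk 0 0 1)
  have hff := g.2 (mk 0 0 1)
  rw [hz, hf, polar_mk, polar_mk] at hzf
  rw [he, hf, polar_mk, polar_mk] at hef
  rw [hf, detForm_mk, detForm_mk] at hff
  have hr : r = 0 := (mul_eq_zero.1 (by linear_combination -hzf : 2 * r = 0)).resolve_left h2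
  have hbc : b * c = 1 := by linear_combination -hef
  have hb : b ≠ 0 := left_ne_zero_of_mul_eq_one hbc
  have hs : s = 0 := by
    refine (mul_eq_zero.1 ?_).resolve_right (right_ne_zero_of_mul_eq_one hbc)
    linear_combination -hff - r * hr
  refine ⟨GeneralLinearGroup.mkOfDetNeZero !![b, 0; 0, 1] (by simpa [det_fin_two_of]), ?_⟩
  refine conjOrth_eq_iff.2 fun M => ?_
  obtain ⟨p, q, t, rfl⟩ := exists_eq_mk M
  have hM : mk p q t = p • mk 1 0 0 + q • mk 0 1 0 + t • mk 0 0 1 := by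
    simp [smul_mk, mk_add_mk]
  have hgM : g.1 (mk p q t) = mk p (q * b) (t * c) := by
    rw [hM, map_add, map_add, map_smul, map_smul, map_smul, hz, he, hf, hr, hs]
    simp [smul_mk, mk_add_mk]
  rw [hgM, coe_mk, coe_mk]
  change !![b, 0; 0, 1] * _ = _ * !![b, 0; 0, 1]
  have htbc : t * c * b = t := by linear_combination t * hbc
  simp [htbc, mul_comm b]

theorem apply_eq_or_of_fixed (h2 : (2 : F) ≠ 0) {g : orthGroup (detForm F)}
    (hz : g.1 (mk 1 0 0) = mk 1 0 0) :
    ∃ b, g.1 (mk 0 1 0) = mk 0 b 0 ∨ g.1 (mk 0 1 0) = mk 0 0 b := by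
  obtain ⟨a, b, c, he⟩ := exists_eq_mk (g.1 (mk 0 1 0))
  have hze := orthGroup_polar g (mk 1 0 0) (mk 0 1 0)
  have hee := g.2 (mk 0 1 0)
  rw [hz, he, polar_mk, polar_mk] at hze
  rw [he, detForm_mk, detForm_mk] at hee
  obtain rfl : a = 0 :=
    (mul_eq_zero.1 (by linear_combination -hze : 2 * a = 0)).resolve_left h2
  obtain rfl | rfl : b = 0 ∨ c = 0 := mul_eq_zero.1 (by linear_combination -hee)
  exacts [⟨c, .inr he⟩, ⟨b, .inl he⟩]

theorem reflectionIn_mk_swap (h : detForm F (mk 0 (-1) 1) ≠ 0) (a b c : F) :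
    (reflectionIn (detForm F) (mk 0 (-1) 1) h).1 (mk a b c) = mk a c b := by
  rw [reflectionIn_apply, detForm_mk, polar_mk, sub_eq_iff_eq_add, smul_mk, mk_add_mk]
  congr 1 <;> ring

theorem center_sup_range_conjOrth (h2 : (2 : F) ≠ 0) :
    Subgroup.center (orthGroup (detForm F)) ⊔ (conjOrth F).range = ⊤ := by
  set K := Subgroup.center (orthGroup (detForm F)) ⊔ (conjOrth F).range
  have hrange : (conjOrth F).range ≤ K := le_sup_right
  have hneg : negIsometry (detForm F) ∈ K := Subgroup.mem_sup_left negIsometry_mem_center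
  have hrefl : ∀ x hx, reflectionIn (detForm F) x hx ∈ K := fun x hx => by
    rw [reflectionIn_eq_negIsometry_mul_conjOrth]
    exact mul_mem hneg (hrange ⟨_, rfl⟩)
  refine eq_top_iff.2 fun g _ => ?_
  obtain ⟨k, hk, hkg⟩ := exists_mem_apply_eq_of_reflectionIn_mem h2 hneg hrefl
    (y := mk 1 0 0) (x := g.1 (mk 1 0 0)) (by rw [g.2, detForm_mk]; simp) (g.2 _)
  suffices hkgK : k * g ∈ K from (Subgroup.mul_mem_cancel_left K hk).1 hkgK
  obtain ⟨b, he | he⟩ := apply_eq_or_of_fixed (g := k * g) h2 hkg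
  · exact hrange (mem_range_conjOrth_of_apply_eq h2 hkg he)
  · have hswap : detForm F (mk 0 (-1) 1) ≠ 0 := by simp [detForm_mk]
    refine (Subgroup.mul_mem_cancel_left K (hrefl _ hswap)).1
      (hrange (mem_range_conjOrth_of_apply_eq (b := b) h2 ?_ ?_))
    · rw [orthGroup_mul_apply, orthGroup_mul_apply, hkg, reflectionIn_mk_swap]
    · rw [orthGroup_mul_apply, he, reflectionIn_mk_swap]

/-- Conjugation by matrices of determinant one. -/
def conjSL (F : Type*) [Field F] : SL(2, F) →* orthGroup (detForm F) :=
  (conjOrth F).comp SpecialLinearGroup.toGL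

theorem omegaGroup_detForm (h2 : (2 : F) ≠ 0) : omegaGroup (detForm F) = (conjSL F).range := by
  rw [omegaGroup, commutator_eq_of_center_sup_eq_top (center_sup_range_conjOrth h2),
    MonoidHom.range_eq_map, ← Subgroup.map_commutator, ← commutator_def, commutator_GL_two h2,
    MonoidHom.map_range, conjSL]

theorem conjSL_apply_eq_iff {s : SL(2, F)} {M N : Traceless F} :
    (conjSL F s).1 M = N ↔ s.1 * M.1 = N.1 * s.1 :=
  conjOrth_apply_eq_iff

theorem ker_conjSL : (conjSL F).ker = Subgroup.center SL(2, F) := by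
  ext s
  rw [MonoidHom.mem_ker, Matrix.SpecialLinearGroup.mem_center_iff]
  constructor
  · intro hs
    have hcomm : ∀ M : Traceless F, s.1 * M.1 = M.1 * s.1 := fun M =>
      conjSL_apply_eq_iff.1 (by rw [hs]; rfl)
    have he := ext_iff.2 (hcomm (mk 0 1 0))
    have hf := ext_iff.2 (hcomm (mk 0 0 1))
    have h10 : s.1 1 0 = 0 := by simpa [mk, mul_apply, Fin.sum_univ_two] using he 1 1
    have h01 : s.1 0 1 = 0 := by simpa [mk, mul_apply, Fin.sum_univ_two] using hf 0 0
    have h11 : s.1 0 0 = s.1 1 1 := by simpa [mk, mul_apply, Fin.sum_univ_two] using he 0 1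
    have hdet := s.2
    rw [det_fin_two, h10, h01, ← h11] at hdet
    refine ⟨s.1 0 0, by rw [Fintype.card_fin]; linear_combination hdet, ?_⟩
    rw [eta_fin_two s.1, h10, h01, ← h11, scalar_apply, diagonal_fin_two]
    rfl
  · rintro ⟨r, -, hr⟩
    refine orthGroup_ext fun M => conjSL_apply_eq_iff.2 ?_
    rw [← hr]
    exact (scalar_commute r (mul_comm r) M.1).eq

theorem nonempty_omegaGroup_detForm_mulEquiv (h2 : (2 : F) ≠ 0) :
    Nonempty (omegaGroup (detForm F) ≃* ProjectiveSpecialLinearGroup (Fin 2) F) :=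
  ⟨(MulEquiv.subgroupCongr (omegaGroup_detForm h2)).trans
    ((QuotientGroup.quotientKerEquivRange (conjSL F)).symm.trans
      (QuotientGroup.quotientMulEquivOfEq ker_conjSL))⟩

theorem exists_polar_eq_zero_detForm_eq_neg_one (w : Traceless F) :
    ∃ x, polar (detForm F) x w = 0 ∧ detForm F x = -1 := by
  obtain ⟨a, b, c, rfl⟩ := exists_eq_mk w
  by_cases hb : b = 0
  · by_cases hc : c = 0
    · exact ⟨mk 0 1 1, by simp [polar_mk, hb, hc], by simp [detForm_mk]⟩
    · refine ⟨mk 1 (-(2 * a) / c) 0, ?_, by simp [detForm_mk]⟩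
      rw [polar_mk, hb]
      field_simp
      ring
  · refine ⟨mk 1 0 (-(2 * a) / b), ?_, by simp [detForm_mk]⟩
    rw [polar_mk]
    field_simp
    ring

theorem reflectionIn_mul_reflectionIn_mem_omegaGroup (h2 : (2 : F) ≠ 0) {x y : Traceless F}
    (hx : detForm F x ≠ 0) (hy : detForm F y ≠ 0) (hxy : detForm F x * detForm F y = 1) :
    reflectionIn (detForm F) x hx * reflectionIn (detForm F) y hy ∈ omegaGroup (detForm F) := by
  have hdet : (x.1 * y.1).det = 1 := by rw [det_mul, ← detForm_apply, ← detForm_apply, hxy]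
  rw [omegaGroup_detForm h2, reflectionIn_eq_negIsometry_mul_conjOrth,
    reflectionIn_eq_negIsometry_mul_conjOrth, ← mul_assoc,
    Subgroup.mem_center_iff.1 negIsometry_mem_center, ← mul_assoc, negIsometry_mul_self, one_mul,
    ← map_mul]
  exact ⟨⟨_, hdet⟩, congrArg (conjOrth F) (Units.ext rfl)⟩

theorem exists_mem_omegaGroup_apply_eq (h2 : (2 : F) ≠ 0) {z : Traceless F}
    (hz0 : detForm F z ≠ 0) (hz : detForm F z = -1) (w : Traceless F) :
    ∃ s ∈ omegaGroup (detForm F), s.1 w = (reflectionIn (detForm F) z hz0).1 w := by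
  obtain ⟨x, hxw, hx⟩ := exists_polar_eq_zero_detForm_eq_neg_one w
  have hx0 : detForm F x ≠ 0 := by rw [hx]; exact neg_ne_zero.2 one_ne_zero
  refine ⟨_, reflectionIn_mul_reflectionIn_mem_omegaGroup h2 hz0 hx0 (by rw [hz, hx]; ring), ?_⟩
  rw [orthGroup_mul_apply, reflectionIn_apply_of_polar_eq_zero hx0 hxw]

theorem exists_reflectionIn_mul_eq (h2 : (2 : F) ≠ 0) {z : Traceless F} (hz0 : detForm F z ≠ 0)
    (hz : detForm F z = -1) {s : orthGroup (detForm F)} (hs : s ∈ omegaGroup (detForm F)) :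
    ∃ h : GL (Fin 2) F, h.1.det = -1 ∧
      reflectionIn (detForm F) z hz0 * s = negIsometry (detForm F) * conjOrth F h := by
  rw [omegaGroup_detForm h2] at hs
  obtain ⟨t, rfl⟩ := hs
  refine ⟨toGL z hz0 * SpecialLinearGroup.toGL t, ?_, ?_⟩
  · rw [Units.val_mul, det_mul, coe_toGL, ← detForm_apply, hz]
    exact (congrArg (-1 * ·) t.2).trans (mul_one _)
  · rw [reflectionIn_eq_negIsometry_mul_conjOrth, map_mul, mul_assoc]
    rfl

theorem mul_add_mul_eq_neg_sub_mul (h : GL (Fin 2) F) (p : Traceless F) :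
    h.1 * p.1 + p.1 * h.1 = -(((negIsometry (detForm F) * conjOrth F h).1 p - p).1 * h.1) := by
  rw [conjOrth_apply_eq_iff.1 rfl, orthGroup_mul_apply, negIsometry_apply, Submodule.coe_sub,
    Submodule.coe_neg, sub_mul, neg_mul, neg_sub, sub_neg_eq_add, add_comm]

theorem trace_eq_zero_of_anticommute (h2 : (2 : F) ≠ 0) {h : Matrix (Fin 2) (Fin 2) F}
    {p : Traceless F} (hp : p ≠ 0) (hanti : h * p.1 + p.1 * h = 0) : h.trace = 0 := by
  have htrace := congrArg trace hanti
  rw [trace_add, trace_mul_comm p.1, ← two_mul, trace_zero] at htrace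
  rw [mul_add_mul, (mul_eq_zero.1 htrace).resolve_left h2, zero_smul, add_zero] at hanti
  exact (smul_eq_zero.1 hanti).resolve_right fun h0 => hp (Subtype.ext h0)

theorem exists_singular_polar_eq_zero (h2 : (2 : F) ≠ 0) {x : Traceless F}
    (hx : detForm F x = -1) :
    ∃ y : Traceless F, y ≠ 0 ∧ detForm F y = 0 ∧ polar (detForm F) x y = 0 := by
  obtain ⟨a, b, c, rfl⟩ := exists_eq_mk x
  rw [detForm_mk] at hx
  by_cases h : a + 1 = 0 ∧ c = 0
  · obtain ⟨ha, rfl⟩ := h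
    obtain rfl : a = -1 := by linear_combination ha
    refine ⟨mk b (-b ^ 2 / 2) 2, fun h0 => h2 (mk_eq_zero.1 h0).2.2, ?_, ?_⟩
    · rw [detForm_mk]
      field_simp
      ring
    · rw [polar_mk]
      ring
  · refine ⟨mk ((a + 1) * c) (-(a + 1) ^ 2) (c ^ 2), fun h0 => h ?_, ?_, ?_⟩
    · rw [mk_eq_zero] at h0
      exact ⟨by simpa using h0.2.1, by simpa using h0.2.2⟩
    · rw [detForm_mk]
      ring
    · rw [polar_mk]
      linear_combination c * hx

/-- Such a matrix `h` anticommutes with `P`, so it is traceless and `P = h^⊥`. -/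
theorem finrank_eq_two_and_exists_singular_of_fixed (h2 : (2 : F) ≠ 0) {h : GL (Fin 2) F}
    (hdet : h.1.det = -1) {P : Submodule F (Traceless F)} (hP : 2 ≤ Module.finrank F P)
    (hfix : ∀ p ∈ P, (negIsometry (detForm F) * conjOrth F h).1 p = p) :
    Module.finrank F P = 2 ∧ ∃ y ∈ P, y ≠ 0 ∧ detForm F y = 0 := by
  have hanti : ∀ p ∈ P, h.1 * p.1 + p.1 * h.1 = 0 := fun p hp => by
    rw [mul_add_mul_eq_neg_sub_mul, hfix p hp, sub_self, Submodule.coe_zero, zero_mul, neg_zero]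
  obtain ⟨p₀, hp₀, hp₀0⟩ := Submodule.exists_mem_ne_zero_of_ne_bot
    (Submodule.one_le_finrank_iff.1 (one_le_two.trans hP))
  set x : Traceless F :=
    ⟨h.1, mem_traceless_iff.2 (trace_eq_zero_of_anticommute h2 hp₀0 (hanti p₀ hp₀))⟩
  have hx : detForm F x = -1 := (detForm_apply x).trans hdet
  set φ : Traceless F →ₗ[F] F := (detForm F).polarBilin x
  have hPφ : P ≤ LinearMap.ker φ := fun p hp => by
    have hxp := coe_mul_coe_add x p
    rw [hanti p hp, eq_comm, smul_eq_zero, neg_eq_zero] at hxp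
    exact hxp.resolve_right one_ne_zero
  have hφ : φ ≠ 0 := fun h0 => by
    have hxx : polar (detForm F) x x = 0 := LinearMap.congr_fun h0 x
    rw [polar_self_eq_two_mul, hx] at hxx
    exact h2 (by linear_combination -hxx)
  have hker := Module.Dual.finrank_ker_add_one_of_ne_zero hφ
  rw [finrank_traceless] at hker
  have hPeq : P = LinearMap.ker φ := Submodule.eq_of_le_of_finrank_le hPφ (by omega)
  obtain ⟨y, hy0, hy, hxy⟩ := exists_singular_polar_eq_zero h2 hx
  exact ⟨by rw [hPeq]; omega, y, hPeq ▸ hxy, hy0, hy⟩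

theorem exists_mul_add_mul_eq_one {w : Traceless F} (hw0 : w ≠ 0) (hw : detForm F w = 0) :
    ∃ f : Traceless F, w.1 * f.1 + f.1 * w.1 = 1 := by
  suffices h : ∃ f : Traceless F, polar (detForm F) w f = -1 by
    obtain ⟨f, hf⟩ := h
    exact ⟨f, by rw [coe_mul_coe_add, hf, neg_neg, one_smul]⟩
  obtain ⟨a, b, c, rfl⟩ := exists_eq_mk w
  by_cases hb : b = 0
  · have ha : a = 0 := by simpa [detForm_mk, hb] using hw
    have hc : c ≠ 0 := fun hc => hw0 (mk_eq_zero.2 ⟨ha, hb, hc⟩)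
    exact ⟨mk 0 c⁻¹ 0, by simp [polar_mk, hc]⟩
  · exact ⟨mk 0 0 b⁻¹, by simp [polar_mk, hb]⟩

theorem coe_mul_coe_self_of_singular {w : Traceless F} (hw : detForm F w = 0) :
    w.1 * w.1 = 0 := by
  rw [coe_mul_coe_self, hw, neg_zero, zero_smul]

theorem mul_mul_of_singular {w : Traceless F} (hw : detForm F w = 0)
    (y : Matrix (Fin 2) (Fin 2) F) : w.1 * y * w.1 = (y * w.1).trace • w.1 := by
  have h := congrArg (w.1 * ·) (mul_add_mul y w)
  simpa only [mul_add, mul_smul_comm, ← mul_assoc, coe_mul_coe_self_of_singular hw, zero_mul,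
    smul_zero, zero_add, add_zero, mul_one] using h

theorem exists_mul_eq_smul {w : Traceless F} (hw0 : w ≠ 0) (hw : detForm F w = 0)
    {y : Matrix (Fin 2) (Fin 2) F} (hy : w.1 * y * w.1 = 0) : ∃ α : F, w.1 * y = α • w.1 := by
  obtain ⟨f, hf⟩ := exists_mul_add_mul_eq_one hw0 hw
  refine ⟨(y * f.1 * w.1).trace, ?_⟩
  calc w.1 * y = w.1 * y * (w.1 * f.1 + f.1 * w.1) := by rw [hf, mul_one]
    _ = w.1 * (y * f.1) * w.1 := by
      rw [mul_add, ← mul_assoc, hy, zero_mul, zero_add]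
      simp only [mul_assoc]
    _ = (y * f.1 * w.1).trace • w.1 := mul_mul_of_singular hw _

theorem mem_span_singleton_of_mul_eq_zero {w x : Traceless F} (hw0 : w ≠ 0) (hw : detForm F w = 0)
    (hwx : w.1 * x.1 = 0) (hxw : x.1 * w.1 = 0) : x ∈ Submodule.span F {w} := by
  obtain ⟨f, hf⟩ := exists_mul_add_mul_eq_one hw0 hw
  have hx : x.1 = w.1 * (f.1 * x.1 * f.1) * w.1 := by
    calc x.1 = (w.1 * f.1 + f.1 * w.1) * x.1 * (w.1 * f.1 + f.1 * w.1) := by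
          rw [hf, one_mul, mul_one]
      _ = w.1 * (f.1 * x.1 * f.1) * w.1 := by
        rw [add_mul, mul_assoc f.1, hwx, mul_zero, add_zero, mul_add, mul_assoc _ x.1,
          ← mul_assoc x.1 w.1, hxw, zero_mul, mul_zero, zero_add]
        simp only [mul_assoc]
  rw [mul_mul_of_singular hw] at hx
  exact Submodule.mem_span_singleton.2 ⟨_, Subtype.ext hx.symm⟩

theorem mul_eq_neg_mul_of_polar_eq_zero {w p : Traceless F} (hwp : polar (detForm F) w p = 0) :
    p.1 * w.1 = -(w.1 * p.1) := by
  have hadd := coe_mul_coe_add w p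
  rw [hwp, neg_zero, zero_smul] at hadd
  exact eq_neg_of_add_eq_zero_right hadd

theorem exists_mul_eq_smul_of_polar_eq_zero {w p : Traceless F} (hw0 : w ≠ 0)
    (hw : detForm F w = 0) (hwp : polar (detForm F) w p = 0) : ∃ β : F, w.1 * p.1 = β • w.1 := by
  refine exists_mul_eq_smul hw0 hw ?_
  rw [mul_assoc, mul_eq_neg_mul_of_polar_eq_zero hwp, mul_neg, ← mul_assoc,
    coe_mul_coe_self_of_singular hw, zero_mul, neg_zero]

theorem mul_eq_zero_of_polar_eq_zero {w l : Traceless F} (hw0 : w ≠ 0) (hw : detForm F w = 0)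
    (hl : detForm F l = 0) (hwl : polar (detForm F) w l = 0) : w.1 * l.1 = 0 := by
  obtain ⟨β, hβ⟩ := exists_mul_eq_smul_of_polar_eq_zero hw0 hw hwl
  have hββ : (β * β) • w.1 = 0 := by
    rw [mul_smul, ← hβ, ← smul_mul_assoc, ← hβ, mul_assoc, coe_mul_coe_self_of_singular hl,
      mul_zero]
  have hw0' : w.1 ≠ 0 := fun h0 => hw0 (Subtype.ext h0)
  rw [hβ, mul_self_eq_zero.1 ((smul_eq_zero.1 hββ).resolve_right hw0'), zero_smul]

/-- For a nonzero `w ∈ L`, multiplying by `w` on the left turns the elements of `P` and `h` into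
scalars, while modulo `L` the two anticommute: so `w` annihilates `P`, whence `P = ⟨w⟩`. -/
theorem radical_eq_bot_of_sub_mem (h2 : (2 : F) ≠ 0) (h : GL (Fin 2) F)
    {P L : Submodule F (Traceless F)} (hP : 2 ≤ Module.finrank F P) (hLP : L ≤ P)
    (horth : ∀ l ∈ L, ∀ p ∈ P, polar (detForm F) l p = 0)
    (hsub : ∀ p ∈ P, (negIsometry (detForm F) * conjOrth F h).1 p - p ∈ L) : L = ⊥ := by
  by_contra hL
  obtain ⟨w, hw, hw0⟩ := Submodule.exists_mem_ne_zero_of_ne_bot hL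
  have hw0' : w.1 ≠ 0 := fun h0 => hw0 (Subtype.ext h0)
  have hsing : ∀ l ∈ L, detForm F l = 0 := fun l hl =>
    (mul_eq_zero.1 (polar_self_eq_two_mul (detForm F) l ▸ horth l hl l (hLP hl))).resolve_left h2
  have hwL : ∀ l ∈ L, w.1 * l.1 = 0 := fun l hl =>
    mul_eq_zero_of_polar_eq_zero hw0 (hsing w hw) (hsing l hl) (horth w hw l (hLP hl))
  have hanti : ∀ p ∈ P, w.1 * h.1 * p.1 + w.1 * p.1 * h.1 = 0 := fun p hp => by
    rw [mul_assoc, mul_assoc, ← mul_add, mul_add_mul_eq_neg_sub_mul, mul_neg, ← mul_assoc,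
      hwL _ (hsub p hp), zero_mul, neg_zero]
  obtain ⟨α, hα⟩ : ∃ α : F, w.1 * h.1 = α • w.1 := by
    refine exists_mul_eq_smul hw0 (hsing w hw) ?_
    simpa only [hwL w hw, zero_mul, add_zero] using hanti w (hLP hw)
  have hα0 : α ≠ 0 := fun hα0 => by
    rw [hα0, zero_smul] at hα
    exact hw0' ((Units.mul_left_eq_zero h).1 hα)
  obtain ⟨x, hxP, hxw⟩ := exists_mem_not_mem_span_singleton hP w
  obtain ⟨β, hβ⟩ := exists_mul_eq_smul_of_polar_eq_zero hw0 (hsing w hw) (horth w hw x hxP)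
  have hαβ : (2 * α * β) • w.1 = 0 := by
    rw [← hanti x hxP, hα, hβ, smul_mul_assoc, smul_mul_assoc, hα, hβ, smul_smul, smul_smul,
      ← add_smul]
    ring_nf
  have hβ0 : β = 0 := (mul_eq_zero.1 ((smul_eq_zero.1 hαβ).resolve_right hw0')).resolve_left
    (mul_ne_zero h2 hα0)
  have hwx : w.1 * x.1 = 0 := by rw [hβ, hβ0, zero_smul]
  exact hxw (mem_span_singleton_of_mul_eq_zero hw0 (hsing w hw) hwx
    (by rw [mul_eq_neg_mul_of_polar_eq_zero (horth w hw x hxP), hwx, neg_zero]))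

/-- An element of `τΩ` acting on `P` as the identity modulo the radical `L` of `P` forces
`L = 0`, and then it is a reflection with axis the hyperbolic line `P`. -/
theorem exists_singular_of_reflectionIn_mul_sub_mem (h2 : (2 : F) ≠ 0) {z : Traceless F}
    (hz0 : detForm F z ≠ 0) (hz : detForm F z = -1) {s : orthGroup (detForm F)}
    (hs : s ∈ omegaGroup (detForm F)) {P L : Submodule F (Traceless F)}
    (hP : 2 ≤ Module.finrank F P) (hLP : L ≤ P)
    (horth : ∀ l ∈ L, ∀ p ∈ P, polar (detForm F) l p = 0)
    (hsub : ∀ p ∈ P, (reflectionIn (detForm F) z hz0 * s).1 p - p ∈ L) :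
    L = ⊥ ∧ Module.finrank F P = 2 ∧ ∃ y ∈ P, y ≠ 0 ∧ detForm F y = 0 := by
  obtain ⟨h, hdet, hh⟩ := exists_reflectionIn_mul_eq h2 hz0 hz hs
  rw [hh] at hsub
  have hL := radical_eq_bot_of_sub_mem h2 h hP hLP horth hsub
  refine ⟨hL, finrank_eq_two_and_exists_singular_of_fixed h2 hdet hP fun p hp => ?_⟩
  exact sub_eq_zero.1 ((Submodule.mem_bot F).1 (hL ▸ hsub p hp))

end Traceless

end Traceless

section Similitude

open QuadraticMap

variable {F X : Type*} [Field F] [AddCommGroup X] [Module F X] {q : QuadraticForm F X} {z : X}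
  {φ : X ≃ₗ[F] Traceless F}

theorem nonempty_omegaGroup_mulEquiv_psl (h2 : (2 : F) ≠ 0) {c : F} (hc : c ≠ 0)
    (hφ : ∀ v, Traceless.detForm F (φ v) = c * q v) :
    Nonempty (omegaGroup q ≃* Matrix.ProjectiveSpecialLinearGroup (Fin 2) F) := by
  obtain ⟨ψ⟩ := Traceless.nonempty_omegaGroup_detForm_mulEquiv h2
  exact ⟨((Subgroup.equivMapOfInjective _ (orthGroupCongr φ hc hφ).toMonoidHom
    (orthGroupCongr φ hc hφ).injective).trans
      (MulEquiv.subgroupCongr (map_omegaGroup_orthGroupCongr hc hφ))).trans ψ⟩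

theorem detForm_apply_eq_neg_one (hz : q z ≠ 0)
    (hφ : ∀ v, Traceless.detForm F (φ v) = -(q z)⁻¹ * q v) :
    Traceless.detForm F (φ z) = -1 := by
  rw [hφ, neg_mul, inv_mul_cancel₀ hz]

theorem detForm_apply_ne_zero (hz : q z ≠ 0)
    (hφ : ∀ v, Traceless.detForm F (φ v) = -(q z)⁻¹ * q v) :
    Traceless.detForm F (φ z) ≠ 0 := by
  rw [detForm_apply_eq_neg_one hz hφ]
  exact neg_ne_zero.2 one_ne_zero

theorem exists_mem_omegaGroup_apply_eq (h2 : (2 : F) ≠ 0) (hz : q z ≠ 0)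
    (hφ : ∀ v, Traceless.detForm F (φ v) = -(q z)⁻¹ * q v) (w : X) :
    ∃ s ∈ omegaGroup q, s.1 w = (reflectionIn q z hz).1 w := by
  have hc : -(q z)⁻¹ ≠ 0 := neg_ne_zero.2 (inv_ne_zero hz)
  have hz' := detForm_apply_ne_zero hz hφ
  obtain ⟨t, ht, htw⟩ := Traceless.exists_mem_omegaGroup_apply_eq h2 hz'
    (detForm_apply_eq_neg_one hz hφ) (φ w)
  rw [← map_omegaGroup_orthGroupCongr hc hφ] at ht
  obtain ⟨s, hs, rfl⟩ := ht
  refine ⟨s, hs, φ.injective ?_⟩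
  rw [← orthGroupCongr_apply hc hφ, ← orthGroupCongr_apply hc hφ,
    orthGroupCongr_reflectionIn hc hφ hz hz']
  exact htw

theorem exists_singular_of_reflectionIn_mul_sub_mem (h2 : (2 : F) ≠ 0) (hz : q z ≠ 0)
    (hφ : ∀ v, Traceless.detForm F (φ v) = -(q z)⁻¹ * q v) {s : orthGroup q}
    (hs : s ∈ omegaGroup q) {P L : Submodule F X} (hP : 2 ≤ Module.finrank F P) (hLP : L ≤ P)
    (horth : ∀ l ∈ L, ∀ p ∈ P, polar q l p = 0)
    (hsub : ∀ p ∈ P, (reflectionIn q z hz * s).1 p - p ∈ L) :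
    L = ⊥ ∧ Module.finrank F P = 2 ∧ ∃ y ∈ P, y ≠ 0 ∧ q y = 0 := by
  have hc : -(q z)⁻¹ ≠ 0 := neg_ne_zero.2 (inv_ne_zero hz)
  have hz' := detForm_apply_ne_zero hz hφ
  have hrank : Module.finrank F (P.map (φ : X →ₗ[F] Traceless F)) = Module.finrank F P :=
    LinearEquiv.finrank_map_eq φ P
  have hs' : orthGroupCongr φ hc hφ s ∈ omegaGroup (Traceless.detForm F) := by
    rw [← map_omegaGroup_orthGroupCongr hc hφ]
    exact Subgroup.mem_map_of_mem _ hs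
  obtain ⟨hL, hP2, _, ⟨y, hy, rfl⟩, hy0, hQy⟩ :=
    Traceless.exists_singular_of_reflectionIn_mul_sub_mem h2 hz'
      (detForm_apply_eq_neg_one hz hφ) hs' (P := P.map (φ : X →ₗ[F] Traceless F))
      (L := L.map (φ : X →ₗ[F] Traceless F)) (hrank ▸ hP) (Submodule.map_mono hLP)
      (by
        rintro _ ⟨l, hl, rfl⟩ _ ⟨p, hp, rfl⟩
        refine (polar_similitude hφ l p).trans ?_
        rw [horth l hl p hp, mul_zero])
      (by
        rintro _ ⟨p, hp, rfl⟩
        refine ⟨_, hsub p hp, ?_⟩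
        rw [← orthGroupCongr_reflectionIn hc hφ hz hz', ← map_mul, LinearEquiv.coe_coe,
          orthGroupCongr_apply, map_sub])
  refine ⟨(Submodule.map_eq_bot_iff (e := φ)).1 hL, hrank ▸ hP2, y, hy, ?_, ?_⟩
  · exact fun h => hy0 (h ▸ map_zero φ)
  · exact (mul_eq_zero.1 ((hφ y).symm.trans hQy)).resolve_left hc

end Similitude

/-! ### Witt index -/

section Witt

open QuadraticMap

variable {F V : Type*} [Field F] [AddCommGroup V] [Module F V] {Q : QuadraticForm F V}
  {X N : Submodule F V} {e f : V}

namespace IsTotallySingular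

theorem polar_eq_zero (hN : IsTotallySingular Q N) {u v : V} (hu : u ∈ N) (hv : v ∈ N) :
    polar Q u v = 0 := by
  rw [polar, hN _ (add_mem hu hv), hN _ hu, hN _ hv, sub_zero, sub_zero]

theorem mono {M : Submodule F V} (hN : IsTotallySingular Q N) (h : M ≤ N) :
    IsTotallySingular Q M :=
  fun v hv => hN v (h hv)

theorem sup_span_singleton (hN : IsTotallySingular Q N) {v : V} (hv : Q v = 0)
    (h : ∀ n ∈ N, polar Q v n = 0) : IsTotallySingular Q (N ⊔ Submodule.span F {v}) := by
  intro x hx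
  obtain ⟨n, hn, y, hy, rfl⟩ := Submodule.mem_sup.1 hx
  obtain ⟨c, rfl⟩ := Submodule.mem_span_singleton.1 hy
  rw [QuadraticMap.map_add Q, hN n hn, QuadraticMap.map_smul, hv, polar_comm, polar_smul_left,
    h n hn, smul_zero, smul_zero, add_zero, add_zero]

end IsTotallySingular

theorem finrank_map_add_finrank_inf_ker {V' : Type*} [AddCommGroup V'] [Module F V']
    [FiniteDimensional F V] (N : Submodule F V) (φ : V →ₗ[F] V') :
    Module.finrank F (N.map φ) + Module.finrank F ↥(N ⊓ LinearMap.ker φ) = Module.finrank F N := by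
  have hker : (LinearMap.ker (φ.domRestrict N)).map N.subtype = N ⊓ LinearMap.ker φ :=
    Submodule.map_comap_subtype N (LinearMap.ker φ)
  rw [← LinearMap.range_domRestrict, ← hker, Submodule.finrank_map_subtype_eq]
  exact LinearMap.finrank_range_add_finrank_ker _

theorem finrank_inf_ker_add_one [FiniteDimensional F V] {φ : V →ₗ[F] F} {x : V} (hx : x ∈ N)
    (hφ : φ x ≠ 0) : Module.finrank F ↥(N ⊓ LinearMap.ker φ) + 1 = Module.finrank F N := by
  have hmap : N.map φ = ⊤ := eq_top_iff.2 fun c _ =>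
    ⟨(c / φ x) • x, Submodule.smul_mem _ _ hx, by
      rw [map_smul, smul_eq_mul, div_mul_cancel₀ _ hφ]⟩
  rw [← finrank_map_add_finrank_inf_ker N φ, hmap, finrank_top, Module.finrank_self, add_comm]

theorem finrank_le_finrank_inf_ker_add_one [FiniteDimensional F V] (N : Submodule F V)
    (φ : V →ₗ[F] F) : Module.finrank F N ≤ Module.finrank F ↥(N ⊓ LinearMap.ker φ) + 1 := by
  rw [← finrank_map_add_finrank_inf_ker N φ, add_comm]
  exact Nat.add_le_add_left ((Submodule.finrank_le _).trans (Module.finrank_self F).le) _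

section WittIndex

variable [FiniteDimensional F V]

theorem bddAbove_finrank_isTotallySingular (Q : QuadraticForm F V) :
    BddAbove {k | ∃ N : Submodule F V, IsTotallySingular Q N ∧ Module.finrank F N = k} :=
  ⟨Module.finrank F V, by rintro _ ⟨N, -, rfl⟩; exact Submodule.finrank_le N⟩

theorem finrank_le_wittIndex (hN : IsTotallySingular Q N) : Module.finrank F N ≤ wittIndex Q :=
  le_csSup (bddAbove_finrank_isTotallySingular Q) ⟨N, hN, rfl⟩

theorem exists_finrank_eq_wittIndex (Q : QuadraticForm F V) :
    ∃ N : Submodule F V, IsTotallySingular Q N ∧ Module.finrank F N = wittIndex Q :=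
  Nat.sSup_mem (s := {k | ∃ N : Submodule F V, IsTotallySingular Q N ∧ Module.finrank F N = k})
    ⟨0, ⊥, fun v hv => by rw [(Submodule.mem_bot F).1 hv, QuadraticMap.map_zero], finrank_bot F V⟩
    (bddAbove_finrank_isTotallySingular Q)

theorem finrank_le_wittIndex_restrictForm (hN : IsTotallySingular Q N) (hNX : N ≤ X) :
    Module.finrank F N ≤ wittIndex (restrictForm Q X) := by
  have hcomap : IsTotallySingular (restrictForm Q X) (N.comap X.subtype) := fun v hv => hN _ hv
  have hle := finrank_le_wittIndex hcomap
  rwa [← Submodule.finrank_map_subtype_eq, Submodule.map_comap_subtype, inf_eq_right.2 hNX] at hle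

theorem exists_finrank_eq_wittIndex_restrictForm (Q : QuadraticForm F V) (X : Submodule F V) :
    ∃ N ≤ X, IsTotallySingular Q N ∧ Module.finrank F N = wittIndex (restrictForm Q X) := by
  obtain ⟨N, hN, hrank⟩ := exists_finrank_eq_wittIndex (restrictForm Q X)
  refine ⟨N.map X.subtype, Submodule.map_subtype_le X N, ?_, ?_⟩
  · rintro _ ⟨v, hv, rfl⟩
    exact hN v hv
  · rw [Submodule.finrank_map_subtype_eq, hrank]

theorem wittIndex_restrictForm_top (Q : QuadraticForm F V) :
    wittIndex (restrictForm Q ⊤) = wittIndex Q := by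
  apply le_antisymm
  · obtain ⟨N, -, hN, hrank⟩ := exists_finrank_eq_wittIndex_restrictForm Q ⊤
    exact hrank ▸ finrank_le_wittIndex hN
  · obtain ⟨N, hN, hrank⟩ := exists_finrank_eq_wittIndex Q
    exact hrank ▸ finrank_le_wittIndex_restrictForm hN le_top

theorem wittIndex_restrictForm_eq_zero (h : ∀ v ∈ X, Q v = 0 → v = 0) :
    wittIndex (restrictForm Q X) = 0 := by
  obtain ⟨N, hNX, hN, hrank⟩ := exists_finrank_eq_wittIndex_restrictForm Q X
  rw [← hrank, Submodule.finrank_eq_zero, Submodule.eq_bot_iff]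
  exact fun v hv => h v (hNX hv) (hN v hv)

end WittIndex

/-- The hyperplane `v^⊥` of vectors orthogonal to `v` (all of `V` if `v` is in the radical). -/
abbrev vectorPerp (Q : QuadraticForm F V) (v : V) : Submodule F V :=
  LinearMap.ker (Q.polarBilin v)

theorem mem_vectorPerp {u v : V} : v ∈ vectorPerp Q u ↔ polar Q u v = 0 := Iff.rfl

/-- A hyperbolic pair `(e, f)` of a quadratic form. -/
structure IsHyperbolicPair (Q : QuadraticForm F V) (e f : V) : Prop where
  left : Q e = 0
  right : Q f = 0
  polar_eq_one : polar Q e f = 1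

namespace IsHyperbolicPair

theorem polar_symm_eq_one (hef : IsHyperbolicPair Q e f) : polar Q f e = 1 := by
  rw [polar_comm, hef.polar_eq_one]

theorem sub_sub_mem (hef : IsHyperbolicPair Q e f) (he : e ∈ X) (hf : f ∈ X) {v : V} (hv : v ∈ X) :
    v - polar Q f v • e - polar Q e v • f ∈ X ⊓ vectorPerp Q e ⊓ vectorPerp Q f := by
  refine ⟨⟨sub_mem (sub_mem hv (Submodule.smul_mem _ _ he)) (Submodule.smul_mem _ _ hf),
    mem_vectorPerp.2 ?_⟩, mem_vectorPerp.2 ?_⟩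
  · rw [polar_sub_right, polar_sub_right,
      polar_smul_right, polar_smul_right, polar_self_eq_zero hef.left, hef.polar_eq_one, smul_zero,
      sub_zero, smul_eq_mul, mul_one, sub_self]
  · rw [polar_sub_right, polar_sub_right,
      polar_smul_right, polar_smul_right, polar_self_eq_zero hef.right, hef.polar_symm_eq_one,
      smul_zero, sub_zero, smul_eq_mul, mul_one, sub_self]

variable [FiniteDimensional F V]

theorem finrank_inf_vectorPerp (hef : IsHyperbolicPair Q e f) (he : e ∈ X) (hf : f ∈ X) :
    Module.finrank F ↥(X ⊓ vectorPerp Q e ⊓ vectorPerp Q f) + 2 = Module.finrank F X := by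
  rw [← finrank_inf_ker_add_one (φ := Q.polarBilin e) hf
      (by rw [polarBilin_apply_apply, hef.polar_eq_one]; exact one_ne_zero),
    ← finrank_inf_ker_add_one (N := X ⊓ vectorPerp Q e) (φ := Q.polarBilin f) (x := e)
      ⟨he, polar_self_eq_zero hef.left⟩
      (by rw [polarBilin_apply_apply, hef.polar_symm_eq_one]; exact one_ne_zero)]

theorem wittIndex_le (hef : IsHyperbolicPair Q e f) (he : e ∈ X) :
    wittIndex (restrictForm Q X) ≤
      wittIndex (restrictForm Q (X ⊓ vectorPerp Q e ⊓ vectorPerp Q f)) + 1 := by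
  obtain ⟨N, hNX, hN, hrank⟩ := exists_finrank_eq_wittIndex_restrictForm Q X
  set M := N ⊓ vectorPerp Q e ⊔ Submodule.span F {e}
  have hM : IsTotallySingular Q M :=
    (hN.mono inf_le_left).sup_span_singleton hef.left fun n hn => hn.2
  have hNM : Module.finrank F N ≤ Module.finrank F M := by
    by_cases heN : e ∈ N
    · exact Submodule.finrank_mono
        (le_sup_of_le_left fun n hn => ⟨hn, hN.polar_eq_zero heN hn⟩)
    · rw [Submodule.finrank_sup_span_singleton fun hmem : e ∈ N ⊓ vectorPerp Q e => heN hmem.1]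
      exact finrank_le_finrank_inf_ker_add_one N _
  have hMX : M ⊓ vectorPerp Q f ≤ X ⊓ vectorPerp Q e ⊓ vectorPerp Q f := by
    refine inf_le_inf_right _ (sup_le (inf_le_inf_right _ hNX) ?_)
    exact (Submodule.span_singleton_le_iff_mem _ _).2 ⟨he, polar_self_eq_zero hef.left⟩
  calc wittIndex (restrictForm Q X) = Module.finrank F N := hrank.symm
    _ ≤ Module.finrank F M := hNM
    _ ≤ Module.finrank F ↥(M ⊓ vectorPerp Q f) + 1 := finrank_le_finrank_inf_ker_add_one M _
    _ ≤ _ := Nat.succ_le_succ (finrank_le_wittIndex_restrictForm (hM.mono inf_le_left) hMX)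

theorem wittIndex_eq (hef : IsHyperbolicPair Q e f) (he : e ∈ X) :
    wittIndex (restrictForm Q X) =
      wittIndex (restrictForm Q (X ⊓ vectorPerp Q e ⊓ vectorPerp Q f)) + 1 := by
  refine le_antisymm (hef.wittIndex_le he) ?_
  obtain ⟨N, hNX, hN, hrank⟩ := exists_finrank_eq_wittIndex_restrictForm Q
    (X ⊓ vectorPerp Q e ⊓ vectorPerp Q f)
  have heN : e ∉ N := fun hmem =>
    one_ne_zero (hef.polar_symm_eq_one.symm.trans (hNX hmem).2)
  rw [← hrank, ← Submodule.finrank_sup_span_singleton heN]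
  refine finrank_le_wittIndex_restrictForm
    (hN.sup_span_singleton hef.left fun n hn => (hNX hn).1.2) (sup_le ?_ ?_)
  · exact hNX.trans (inf_le_left.trans inf_le_left)
  · exact (Submodule.span_singleton_le_iff_mem _ _).2 he

end IsHyperbolicPair

theorem isNondegenerate_restrictForm_iff :
    IsNondegenerate (restrictForm Q X) ↔ ∀ v ∈ X, (∀ u ∈ X, polar Q u v = 0) → v = 0 :=
  ⟨fun h v hv hperp => congrArg Subtype.val (h ⟨v, hv⟩ fun u => hperp u u.2),
    fun h v hv => Subtype.ext (h v v.2 fun u hu => hv ⟨u, hu⟩)⟩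

theorem isNondegenerate_restrictForm_top (hQ : IsNondegenerate Q) :
    IsNondegenerate (restrictForm Q ⊤) :=
  isNondegenerate_restrictForm_iff.2 fun v _ hv => hQ v fun u => hv u Submodule.mem_top

theorem exists_isHyperbolicPair (hX : IsNondegenerate (restrictForm Q X)) (he : e ∈ X)
    (he0 : e ≠ 0) (hQe : Q e = 0) : ∃ f ∈ X, IsHyperbolicPair Q e f := by
  obtain ⟨u, hu, hue⟩ : ∃ u ∈ X, polar Q e u ≠ 0 := by
    by_contra! hcon
    exact he0 (isNondegenerate_restrictForm_iff.1 hX e he fun u hu => by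
      rw [polar_comm, hcon u hu])
  obtain ⟨w, hw, hew⟩ : ∃ w ∈ X, polar Q e w = 1 :=
    ⟨(polar Q e u)⁻¹ • u, Submodule.smul_mem _ _ hu, by
      rw [polar_smul_right, smul_eq_mul, inv_mul_cancel₀ hue]⟩
  refine ⟨w - Q w • e, sub_mem hw (Submodule.smul_mem _ _ he), hQe, ?_, ?_⟩
  · rw [sub_eq_add_neg, ← neg_smul, QuadraticMap.map_add Q, QuadraticMap.map_smul, hQe,
      polar_smul_right, polar_comm, hew, smul_zero, add_zero, smul_eq_mul, mul_one, add_neg_cancel]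
  · rw [polar_sub_right, hew, polar_smul_right, polar_self_eq_zero hQe, smul_zero, sub_zero]

theorem IsHyperbolicPair.isNondegenerate_restrictForm (hef : IsHyperbolicPair Q e f)
    (he : e ∈ X) (hf : f ∈ X) (hX : IsNondegenerate (restrictForm Q X)) :
    IsNondegenerate (restrictForm Q (X ⊓ vectorPerp Q e ⊓ vectorPerp Q f)) := by
  rw [isNondegenerate_restrictForm_iff] at hX ⊢
  rintro v ⟨⟨hvX, hve⟩, hvf⟩ hv
  refine hX v hvX fun u hu => ?_
  have hproj := hv _ (hef.sub_sub_mem he hf hu)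
  rwa [polar_sub_left, polar_sub_left, polar_smul_left, polar_smul_left,
    show polar Q e v = 0 from hve, show polar Q f v = 0 from hvf, smul_zero, smul_zero, sub_zero,
    sub_zero] at hproj

theorem finrank_inf_vectorPerp_add_one [FiniteDimensional F V] (h2 : (2 : F) ≠ 0) {z : V}
    (hz : z ∈ X) (hQz : Q z ≠ 0) :
    Module.finrank F ↥(X ⊓ vectorPerp Q z) + 1 = Module.finrank F X :=
  finrank_inf_ker_add_one hz (by
    rw [polarBilin_apply_apply, polar_self_eq_two_mul]
    exact mul_ne_zero h2 hQz)

theorem isNondegenerate_restrictForm_inf_vectorPerp (h2 : (2 : F) ≠ 0)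
    (hX : IsNondegenerate (restrictForm Q X)) {z : V} (hz : z ∈ X) (hQz : Q z ≠ 0) :
    IsNondegenerate (restrictForm Q (X ⊓ vectorPerp Q z)) := by
  rw [isNondegenerate_restrictForm_iff] at hX ⊢
  rintro v ⟨hvX, hvz⟩ hv
  refine hX v hvX fun u hu => ?_
  have hmem : u - (polar Q z u / (2 * Q z)) • z ∈ X ⊓ vectorPerp Q z := by
    refine ⟨sub_mem hu (Submodule.smul_mem _ _ hz), mem_vectorPerp.2 ?_⟩
    rw [polar_sub_right, polar_smul_right,
      polar_self_eq_two_mul, smul_eq_mul, div_mul_cancel₀ _ (mul_ne_zero h2 hQz), sub_self]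
  have hproj := hv _ hmem
  rwa [polar_sub_left, polar_smul_left, show polar Q z v = 0 from hvz, smul_zero, sub_zero]
    at hproj

theorem exists_orthogonal_triple_of_anisotropic [FiniteDimensional F V]
    (hX : ∀ v ∈ X, v ≠ 0 → Q v ≠ 0) (hrank : 3 ≤ Module.finrank F X) :
    ∃ x ∈ X, ∃ y ∈ X, ∃ w ∈ X, (Q x ≠ 0 ∧ Q y ≠ 0 ∧ Q w ≠ 0) ∧
      polar Q x y = 0 ∧ polar Q x w = 0 ∧ polar Q y w = 0 := by
  have hexists : ∀ N ≤ X, 1 ≤ Module.finrank F N → ∃ x ∈ N, Q x ≠ 0 := fun N hN hN1 => by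
    obtain ⟨x, hx, hx0⟩ :=
      Submodule.exists_mem_ne_zero_of_ne_bot (Submodule.one_le_finrank_iff.1 hN1)
    exact ⟨x, hx, hX x (hN hx) hx0⟩
  obtain ⟨x, hx, hQx⟩ := hexists X le_rfl (by omega)
  have hrank_x : _ ≤ Module.finrank F ↥(X ⊓ vectorPerp Q x) + 1 :=
    finrank_le_finrank_inf_ker_add_one X _
  obtain ⟨y, hy, hQy⟩ := hexists (X ⊓ vectorPerp Q x) inf_le_left (by omega)
  have hrank_y : _ ≤ Module.finrank F ↥(X ⊓ vectorPerp Q x ⊓ vectorPerp Q y) + 1 :=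
    finrank_le_finrank_inf_ker_add_one _ _
  obtain ⟨w, hw, hQw⟩ := hexists (X ⊓ vectorPerp Q x ⊓ vectorPerp Q y)
    (inf_le_left.trans inf_le_left) (by omega)
  exact ⟨x, hx, y, hy.1, w, hw.1.1, ⟨hQx, hQy, hQw⟩, hy.2, hw.1.2, hw.2⟩

theorem exists_mul_sq_add_mul_sq_add_eq_zero [Finite F] (hF : Odd (Nat.card F)) {α β : F}
    (hα : α ≠ 0) (hβ : β ≠ 0) (γ : F) : ∃ a b : F, α * a ^ 2 + β * b ^ 2 + γ = 0 := by
  open Polynomial in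
  have := Fintype.ofFinite F
  obtain ⟨a, b, hab⟩ := FiniteField.exists_root_sum_quadratic
    (f := C α * X ^ 2 + C 0 * X + C γ) (g := C β * X ^ 2 + C 0 * X + C 0)
    (degree_quadratic hα) (degree_quadratic hβ) (by rwa [← Nat.card_eq_fintype_card, ← Nat.odd_iff])
  simp only [eval_add, eval_mul, eval_C, eval_pow, eval_X] at hab
  exact ⟨a, b, by linear_combination hab⟩

theorem ringChar_ne_two_of_odd_card [Finite F] (hF : Odd (Nat.card F)) : ringChar F ≠ 2 := by
  have := Fintype.ofFinite F
  rw [Nat.card_eq_fintype_card, Nat.odd_iff] at hF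
  exact fun hchar => Nat.zero_ne_one ((FiniteField.even_card_of_char_two hchar).symm.trans hF)

theorem two_ne_zero_of_odd_card [Finite F] (hF : Odd (Nat.card F)) : (2 : F) ≠ 0 :=
  Ring.two_ne_zero (ringChar_ne_two_of_odd_card hF)

theorem eq_zero_of_apply_eq_zero_of_finrank_eq_one [FiniteDimensional F V]
    (hX : IsNondegenerate (restrictForm Q X))
    (hrank : Module.finrank F X = 1) {v : V} (hv : v ∈ X) (hQv : Q v = 0) : v = 0 := by
  by_contra hv0
  obtain ⟨f, hf, hvf⟩ := exists_isHyperbolicPair hX hv hv0 hQv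
  have := hvf.finrank_inf_vectorPerp hv hf
  omega

/-- On `(e + Q(y)ν f)^⊥ ∩ ⟨y, e, f⟩` the form is `Q(y)(c² - ν b²)`. -/
theorem IsHyperbolicPair.anisotropic_of_not_isSquare (hef : IsHyperbolicPair Q e f) {y : V}
    (hey : polar Q e y = 0) (hfy : polar Q f y = 0) (hQy : Q y ≠ 0) {ν : F} (hν : ¬IsSquare ν)
    {a b c : F} (hperp : polar Q (e + (Q y * ν) • f) (c • y + b • e + a • f) = 0)
    (hsing : Q (c • y + b • e + a • f) = 0) : c • y + b • e + a • f = 0 := by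
  simp only [polar_add_left, polar_add_right, polar_smul_left, polar_smul_right, hey, hfy,
    polar_self_eq_zero hef.left, polar_self_eq_zero hef.right, hef.polar_eq_one,
    hef.polar_symm_eq_one, smul_eq_mul, mul_zero, mul_one, zero_add, add_zero] at hperp
  simp only [QuadraticMap.map_add Q, QuadraticMap.map_smul, polar_add_left, polar_smul_left,
    polar_smul_right, polar_comm Q y, hey, hfy, hef.polar_eq_one, hef.left, hef.right,
    smul_eq_mul, mul_zero, mul_one, add_zero, zero_add] at hsing
  have hcb : c ^ 2 = ν * b ^ 2 := mul_right_cancel₀ hQy (by linear_combination hsing - b * hperp)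
  obtain rfl : b = 0 := by
    by_contra hb
    exact hν ⟨c / b, by field_simp; linear_combination -hcb⟩
  obtain rfl : c = 0 := by simpa using hcb
  obtain rfl : a = 0 := by simpa using hperp
  simp only [zero_smul, add_zero]

section FiniteField

variable [Finite F] [FiniteDimensional F V]

theorem exists_singular_of_three_le_finrank (hF : Odd (Nat.card F)) (Q : QuadraticForm F V)
    (hrank : 3 ≤ Module.finrank F X) : ∃ v ∈ X, v ≠ 0 ∧ Q v = 0 := by
  by_contra! hcon
  obtain ⟨x, hx, y, hy, w, hw, ⟨hQx, hQy, hQw⟩, hxy, hxw, hyw⟩ :=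
    exists_orthogonal_triple_of_anisotropic hcon hrank
  obtain ⟨a, b, hab⟩ := exists_mul_sq_add_mul_sq_add_eq_zero hF hQx hQy (Q w)
  refine hcon (a • x + b • y + w) (add_mem (add_mem (Submodule.smul_mem _ _ hx)
    (Submodule.smul_mem _ _ hy)) hw) (fun h0 => ?_) ?_
  · have hpolar : polar Q (a • x + b • y + w) w = 2 * Q w := by
      rw [polar_add_left, polar_add_left, polar_smul_left, polar_smul_left, hxw, hyw,
        polar_self_eq_two_mul, smul_zero, smul_zero, zero_add, zero_add]
    rw [h0, polar_zero_left] at hpolar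
    exact mul_ne_zero (two_ne_zero_of_odd_card hF) hQw hpolar.symm
  · rw [QuadraticMap.map_add Q, QuadraticMap.map_add Q, polar_add_left, polar_smul_left,
      polar_smul_left, polar_smul_left, polar_smul_right, hxy, hxw, hyw, QuadraticMap.map_smul,
      QuadraticMap.map_smul]
    simp only [smul_eq_mul]
    linear_combination hab

theorem exists_isHyperbolicPair_of_three_le_finrank (hF : Odd (Nat.card F))
    (hX : IsNondegenerate (restrictForm Q X)) (hrank : 3 ≤ Module.finrank F X) :
    ∃ e ∈ X, ∃ f ∈ X, IsHyperbolicPair Q e f := by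
  obtain ⟨e, he, he0, hQe⟩ := exists_singular_of_three_le_finrank hF Q hrank
  exact ⟨e, he, exists_isHyperbolicPair hX he he0 hQe⟩

theorem wittIndex_restrictForm_eq_of_finrank_eq (hF : Odd (Nat.card F)) (d : ℕ)
    (hX : IsNondegenerate (restrictForm Q X)) (hrank : Module.finrank F X = 2 * d + 1) :
    wittIndex (restrictForm Q X) = d := by
  induction d generalizing X with
  | zero =>
    exact wittIndex_restrictForm_eq_zero fun v =>
      eq_zero_of_apply_eq_zero_of_finrank_eq_one hX hrank
  | succ d ih =>
    obtain ⟨e, he, f, hf, hef⟩ := exists_isHyperbolicPair_of_three_le_finrank hF hX (by omega)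
    have := hef.finrank_inf_vectorPerp he hf
    rw [hef.wittIndex_eq he, ih (hef.isNondegenerate_restrictForm he hf hX) (by omega)]

theorem exists_anisotropic_hyperplane_of_finrank_eq_three (hF : Odd (Nat.card F))
    (hX : IsNondegenerate (restrictForm Q X)) (hrank : Module.finrank F X = 3) :
    ∃ z ∈ X, Q z ≠ 0 ∧ wittIndex (restrictForm Q (X ⊓ vectorPerp Q z)) = 0 := by
  obtain ⟨e, he, f, hf, hef⟩ := exists_isHyperbolicPair_of_three_le_finrank hF hX hrank.ge
  have hrank' : Module.finrank F ↥(X ⊓ vectorPerp Q e ⊓ vectorPerp Q f) = 1 := by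
    have := hef.finrank_inf_vectorPerp he hf
    omega
  obtain ⟨y, hy, hy0⟩ := Submodule.exists_mem_ne_zero_of_ne_bot
    (Submodule.one_le_finrank_iff.1 hrank'.ge)
  have hQy : Q y ≠ 0 := fun hQy => hy0 (eq_zero_of_apply_eq_zero_of_finrank_eq_one
    (hef.isNondegenerate_restrictForm he hf hX) hrank' hy hQy)
  obtain ⟨ν, hν⟩ := FiniteField.exists_nonsquare (ringChar_ne_two_of_odd_card hF)
  have hQz : Q (e + (Q y * ν) • f) = Q y * ν := by
    rw [QuadraticMap.map_add Q, QuadraticMap.map_smul, hef.left, hef.right, polar_smul_right,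
      hef.polar_eq_one, smul_zero, add_zero, zero_add, smul_eq_mul, mul_one]
  refine ⟨e + (Q y * ν) • f, add_mem he (Submodule.smul_mem _ _ hf), ?_,
    wittIndex_restrictForm_eq_zero fun v hv hQv => ?_⟩
  · rw [hQz]
    exact mul_ne_zero hQy fun hν0 => hν (hν0 ▸ IsSquare.zero)
  · have hspan := (finrank_eq_one_iff_of_nonzero' (⟨y, hy⟩ : ↥(X ⊓ _ ⊓ _))
      fun h0 => hy0 (congrArg Subtype.val h0)).1 hrank' ⟨_, hef.sub_sub_mem he hf hv.1⟩
    obtain ⟨c, hc⟩ := hspan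
    have hv' : v = c • y + polar Q f v • e + polar Q e v • f := by
      rw [show c • y = _ from congrArg Subtype.val hc]
      module
    rw [hv'] at hQv ⊢
    exact hef.anisotropic_of_not_isSquare hy.1.2 hy.2 hQy hν (hv' ▸ hv.2) hQv

theorem exists_hyperplane_wittIndex_eq (hF : Odd (Nat.card F)) (d : ℕ)
    (hX : IsNondegenerate (restrictForm Q X))
    (hrank : Module.finrank F X = 2 * (d + 1) + 1) :
    ∃ z ∈ X, Q z ≠ 0 ∧ wittIndex (restrictForm Q (X ⊓ vectorPerp Q z)) = d := by
  induction d generalizing X with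
  | zero => exact exists_anisotropic_hyperplane_of_finrank_eq_three hF hX hrank
  | succ d ih =>
    obtain ⟨e, he, f, hf, hef⟩ := exists_isHyperbolicPair_of_three_le_finrank hF hX (by omega)
    have hrank' := hef.finrank_inf_vectorPerp he hf
    obtain ⟨z, hz, hQz, hind⟩ := ih (hef.isNondegenerate_restrictForm he hf hX) (by omega)
    have hze : polar Q z e = 0 := (polar_comm Q z e).trans hz.1.2
    refine ⟨z, hz.1.1, hQz, ?_⟩
    rw [hef.wittIndex_eq (X := X ⊓ vectorPerp Q z) ⟨he, hze⟩, inf_right_comm X (vectorPerp Q z),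
      inf_right_comm _ (vectorPerp Q z) (vectorPerp Q f), hind]

end FiniteField

theorem mem_perp_span {S : Set V} {v : V} :
    v ∈ perp Q (Submodule.span F S) ↔ ∀ s ∈ S, polar Q s v = 0 := by
  refine ⟨fun h s hs => h s (Submodule.subset_span hs), fun h w hw => ?_⟩
  have hle : Submodule.span F S ≤ vectorPerp Q v :=
    Submodule.span_le.2 fun s hs => mem_vectorPerp.2 (by rw [polar_comm, h s hs])
  rw [polar_comm]
  exact hle hw

theorem perp_frameSpace (Q : QuadraticForm F V) (z e f : V) :
    perp Q (frameSpace F z e f) = ⊤ ⊓ vectorPerp Q z ⊓ vectorPerp Q e ⊓ vectorPerp Q f := by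
  ext v
  rw [frameSpace, mem_perp_span]
  simp [and_assoc]

theorem exists_isFrame [Finite F] [FiniteDimensional F V] (hF : Odd (Nat.card F)) {d : ℕ}
    (hd : 2 ≤ d) (hV : Module.finrank F V = 2 * d + 1) (hQ : IsNondegenerate Q) :
    ∃ z e f : V, IsFrame Q z e f := by
  have h2 := two_ne_zero_of_odd_card hF
  obtain ⟨d, rfl⟩ := Nat.exists_eq_add_of_le' hd
  have hQ' := isNondegenerate_restrictForm_top hQ
  obtain ⟨z, hz, hQz, hind⟩ := exists_hyperplane_wittIndex_eq hF (d + 1) hQ'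
    (by rw [finrank_top, hV])
  have hrank := finrank_inf_vectorPerp_add_one h2 hz hQz
  rw [finrank_top] at hrank
  have hnd := isNondegenerate_restrictForm_inf_vectorPerp h2 hQ' hz hQz
  obtain ⟨e, he, f, hf, hef⟩ := exists_isHyperbolicPair_of_three_le_finrank hF hnd (by omega)
  refine ⟨z, e, f, hQz, hef.left, hef.right, hef.polar_eq_one, he.2, hf.2, ?_⟩
  rw [perp_frameSpace]
  have hwitt := hef.wittIndex_eq he
  have hrank' := hef.finrank_inf_vectorPerp he hf
  exact ⟨hef.isNondegenerate_restrictForm he hf hnd, by omega⟩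

theorem wittIndex_eq_of_finrank_eq [Finite F] [FiniteDimensional F V] (hF : Odd (Nat.card F))
    {d : ℕ} (hV : Module.finrank F V = 2 * d + 1) (hQ : IsNondegenerate Q) : wittIndex Q = d := by
  rw [← wittIndex_restrictForm_top]
  exact wittIndex_restrictForm_eq_of_finrank_eq hF d (isNondegenerate_restrictForm_top hQ)
    (by rw [finrank_top, hV])

end Witt

/-! ### Orthogonal complements -/

section Complement

open QuadraticMap

variable {F V : Type*} [Field F] [AddCommGroup V] [Module F V] {Q : QuadraticForm F V}
  {W : Submodule F V}

theorem map_add_of_mem_perp {w u : V} (hw : w ∈ W) (hu : u ∈ perp Q W) :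
    Q (w + u) = Q w + Q u := by
  rw [QuadraticMap.map_add Q, hu w hw, add_zero]

theorem sub_projectionOnto_mem_perp (hW : IsCompl W (perp Q W)) (v : V) :
    v - W.projectionOnto _ hW v ∈ perp Q W :=
  Submodule.sub_projection_mem hW v

theorem polar_projectionOnto (hW : IsCompl W (perp Q W)) {w : V} (hw : w ∈ W) (v : V) :
    polar Q w (W.projectionOnto _ hW v) = polar Q w v := by
  have hperp := sub_projectionOnto_mem_perp hW v w hw
  rw [polar_sub_right, sub_eq_zero] at hperp
  exact hperp.symm

/-- The embedding `g ↦ g ⊕ 1` of `O(W)` into `O(V)`, for `V = W ⊕ W^⊥`. -/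
noncomputable def extendIsometry (hW : IsCompl W (perp Q W)) :
    orthGroup (restrictForm Q W) →* orthGroup Q where
  toFun g :=
    ⟨((W.prodEquivOfIsCompl _ hW).symm.trans (g.1.prodCongr (.refl F _))).trans
      (W.prodEquivOfIsCompl _ hW), fun v => by
        obtain ⟨⟨w, u⟩, rfl⟩ := (W.prodEquivOfIsCompl _ hW).surjective v
        have hg : Q (g.1 w : V) = Q w := g.2 w
        simp [map_add_of_mem_perp w.2 u.2, map_add_of_mem_perp (g.1 w).2 u.2, hg]⟩
  map_one' := orthGroup_ext fun v => (W.prodEquivOfIsCompl _ hW).apply_symm_apply v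
  map_mul' g k := orthGroup_ext fun v => by
    obtain ⟨⟨w, u⟩, rfl⟩ := (W.prodEquivOfIsCompl _ hW).surjective v
    simp

theorem extendIsometry_coe (hW : IsCompl W (perp Q W)) (g : orthGroup (restrictForm Q W))
    (w : W) : (extendIsometry hW g).1 w = (g.1 w : V) := by
  simp [extendIsometry]

theorem extendIsometry_of_mem_perp (hW : IsCompl W (perp Q W)) (g : orthGroup (restrictForm Q W))
    {u : V} (hu : u ∈ perp Q W) : (extendIsometry hW g).1 u = u := by
  lift u to perp Q W using hu
  simp [extendIsometry]

theorem extendIsometry_sub_self (hW : IsCompl W (perp Q W)) (g : orthGroup (restrictForm Q W))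
    (v : V) : (extendIsometry hW g).1 v - v =
      (g.1 (W.projectionOnto _ hW v) - W.projectionOnto _ hW v : W) := by
  have hu := extendIsometry_of_mem_perp hW g (sub_projectionOnto_mem_perp hW v)
  rw [map_sub, extendIsometry_coe] at hu
  rw [Submodule.coe_sub]
  linear_combination (norm := module) hu

theorem extendIsometry_injective (hW : IsCompl W (perp Q W)) :
    Function.Injective (extendIsometry hW) := fun g k hgk => orthGroup_ext fun w => by
  apply Subtype.ext
  rw [← extendIsometry_coe hW, ← extendIsometry_coe hW, hgk]

theorem map_omegaGroup_extendIsometry (hW : IsCompl W (perp Q W)) :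
    (omegaGroup (restrictForm Q W)).map (extendIsometry hW) = omegaOn Q W := by
  ext k
  constructor
  · rintro ⟨g, hg, rfl⟩
    exact ⟨g, hg, extendIsometry_coe hW g, fun u => extendIsometry_of_mem_perp hW g⟩
  · rintro ⟨g, hg, hgW, hgU⟩
    refine ⟨g, hg, orthGroup_ext fun v => ?_⟩
    obtain ⟨⟨w, u⟩, rfl⟩ := (W.prodEquivOfIsCompl _ hW).surjective v
    rw [Submodule.coe_prodEquivOfIsCompl', map_add, map_add, extendIsometry_coe,
      extendIsometry_of_mem_perp hW g u.2, hgW, hgU u u.2]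

theorem nonempty_omegaOn_mulEquiv (hW : IsCompl W (perp Q W)) :
    Nonempty (omegaOn Q W ≃* omegaGroup (restrictForm Q W)) :=
  ⟨(MulEquiv.subgroupCongr (map_omegaGroup_extendIsometry hW)).symm.trans
    (Subgroup.equivMapOfInjective _ _ (extendIsometry_injective hW)).symm⟩

theorem extendIsometry_reflectionIn (hW : IsCompl W (perp Q W)) {z : W}
    (hzW : restrictForm Q W z ≠ 0) (hz : Q z ≠ 0) :
    extendIsometry hW (reflectionIn _ z hzW) = reflectionIn Q z hz := by
  refine orthGroup_ext fun v => ?_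
  have hpolar : polar (restrictForm Q W) z (W.projectionOnto _ hW v) = polar Q z v :=
    polar_projectionOnto hW z.2 v
  rw [← sub_left_inj (a := v), extendIsometry_sub_self, reflectionIn_apply, reflectionIn_apply,
    hpolar, sub_sub_cancel_left, sub_sub_cancel_left]
  rfl

theorem conj_reflectionIn_mem_omegaOn (hW : IsCompl W (perp Q W)) {z : V} (hzW : z ∈ W)
    (hz : Q z ≠ 0) {b : orthGroup Q} (hb : b ∈ omegaOn Q W) :
    reflectionIn Q z hz * b * reflectionIn Q z hz ∈ omegaOn Q W := by
  lift z to W using hzW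
  have hzW : restrictForm Q W z ≠ 0 := hz
  rw [← map_omegaGroup_extendIsometry hW] at hb ⊢
  obtain ⟨s, hs, rfl⟩ := hb
  have hnormal : (omegaGroup (restrictForm Q W)).Normal := by
    unfold omegaGroup
    infer_instance
  refine ⟨_, hnormal.conj_mem s hs (reflectionIn _ z hzW), ?_⟩
  rw [map_mul, map_mul, map_inv, extendIsometry_reflectionIn hW hzW hz,
    inv_eq_of_mul_eq_one_left (reflectionIn_mul_self hz)]

theorem finrank_projectionOnto_add_finrank_inf_perp [FiniteDimensional F V]
    (hW : IsCompl W (perp Q W)) (m : Submodule F V) :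
    Module.finrank F (m.map (W.projectionOnto _ hW)) + Module.finrank F ↥(m ⊓ perp Q W) =
      Module.finrank F m := by
  rw [← finrank_map_add_finrank_inf_ker m (W.projectionOnto _ hW), Submodule.ker_projectionOnto]

/-- A singular vector `p` in the projection of `m`, say of `p + u ∈ m`, provides a singular `u`
in `W^⊥` orthogonal to `m ∩ W^⊥`. -/
theorem finrank_inf_perp_lt_wittIndex [FiniteDimensional F V] (hW : IsCompl W (perp Q W))
    {m : Submodule F V} (hm : IsTotallySingular Q m) (hmW : m.comap W.subtype = ⊥) {p : W}
    (hp : p ∈ m.map (W.projectionOnto _ hW)) (hp0 : p ≠ 0) (hQp : Q p = 0) :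
    Module.finrank F ↥(m ⊓ perp Q W) < wittIndex (restrictForm Q (perp Q W)) := by
  obtain ⟨v, hv, rfl⟩ := hp
  set p := W.projectionOnto _ hW v
  have hu : v - p ∈ perp Q W := sub_projectionOnto_mem_perp hW v
  have hQu : Q (v - p) = 0 := by
    have hadd := map_add_of_mem_perp p.2 hu
    rwa [add_sub_cancel, hm v hv, hQp, zero_add, eq_comm] at hadd
  have hunot : v - p ∉ m ⊓ perp Q W := fun hmem => by
    have hpm : (p : V) ∈ m := by
      rw [← sub_sub_cancel v (p : V)]
      exact sub_mem hv hmem.1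
    exact hp0 ((Submodule.mem_bot F).1 (hmW ▸ hpm))
  have hsing : IsTotallySingular Q (m ⊓ perp Q W ⊔ Submodule.span F {v - (p : V)}) :=
    (hm.mono inf_le_left).sup_span_singleton hQu fun n hn => by
      rw [polar_sub_left, hm.polar_eq_zero hv hn.1, hn.2 p p.2, sub_zero]
  rw [Nat.lt_iff_add_one_le, ← Submodule.finrank_sup_span_singleton hunot]
  exact finrank_le_wittIndex_restrictForm hsing
    (sup_le inf_le_right ((Submodule.span_singleton_le_iff_mem _ _).2 hu))

/-- An isometry `g ⊕ 1` maps `w + u` to `g w + u`, so it cannot rescale it. -/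
theorem apply_eq_self_of_extendIsometry_mem_span (hW : IsCompl W (perp Q W))
    {g : orthGroup (restrictForm Q W)} {w : W} {u : V} (hu : u ∈ perp Q W) (hu0 : u ≠ 0)
    (h : (extendIsometry hW g).1 (w + u) ∈ Submodule.span F {(w + u : V)}) : g.1 w = w := by
  obtain ⟨c, hc⟩ := Submodule.mem_span_singleton.1 h
  rw [map_add, extendIsometry_coe, extendIsometry_of_mem_perp hW g hu] at hc
  have hdiff : ((g.1 w - c • w : W) : V) = (c - 1) • u := by
    rw [Submodule.coe_sub, Submodule.coe_smul]
    linear_combination (norm := module) -hc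
  have hzero : ((g.1 w - c • w : W) : V) = 0 :=
    Submodule.disjoint_def.1 hW.disjoint _ (SetLike.coe_mem _)
      (hdiff ▸ Submodule.smul_mem _ _ hu)
  have hc1 : c = 1 := sub_eq_zero.1 ((smul_eq_zero.1 (hdiff ▸ hzero)).resolve_right hu0)
  rw [hc1, one_smul, ZeroMemClass.coe_eq_zero, sub_eq_zero] at hzero
  exact hzero

theorem extendIsometry_sub_mem_comap {W m : Submodule F V} (hW : IsCompl W (perp Q W))
    {g : orthGroup (restrictForm Q W)} (hg : m.map ((extendIsometry hW g).1 : V →ₗ[F] V) = m)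
    {p : W} (hp : p ∈ m.map (W.projectionOnto _ hW)) : g.1 p - p ∈ m.comap W.subtype := by
  obtain ⟨v, hv, rfl⟩ := hp
  have hgv : (extendIsometry hW g).1 v ∈ m := hg.le (Submodule.mem_map_of_mem hv)
  have hsub := sub_mem hgv hv
  rwa [extendIsometry_sub_self] at hsub

theorem comap_subtype_le_map_projectionOnto {W W' : Submodule F V} (hW : IsCompl W W')
    (m : Submodule F V) : m.comap W.subtype ≤ m.map (W.projectionOnto _ hW) :=
  fun l hl => ⟨l, hl, Submodule.projectionOnto_apply_left hW l⟩

theorem polar_eq_zero_of_mem_map_projectionOnto {W m : Submodule F V} (hW : IsCompl W (perp Q W))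
    (hm : IsTotallySingular Q m) {l p : W} (hl : l ∈ m.comap W.subtype)
    (hp : p ∈ m.map (W.projectionOnto _ hW)) : polar (restrictForm Q W) l p = 0 := by
  obtain ⟨v, hv, rfl⟩ := hp
  exact (polar_projectionOnto hW l.2 v).trans (hm.polar_eq_zero hl hv)

end Complement

/-! ### Frames -/

section Frame

open QuadraticMap

variable {F V : Type*} [Field F] [AddCommGroup V] [Module F V] {Q : QuadraticForm F V} {z e f : V}

theorem mem_frameSpace_left (z e f : V) : z ∈ frameSpace F z e f :=
  Submodule.subset_span (by simp)

theorem mem_frameSpace_mid (z e f : V) : e ∈ frameSpace F z e f :=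
  Submodule.subset_span (by simp)

theorem mem_frameSpace_right (z e f : V) : f ∈ frameSpace F z e f :=
  Submodule.subset_span (by simp)

theorem exists_eq_combination (w : frameSpace F z e f) :
    ∃ a b c : F, (w : V) = a • z + b • e + c • f := by
  obtain ⟨a, b, c, h⟩ := Submodule.mem_span_triple.1 w.2
  exact ⟨a, b, c, h.symm⟩

namespace IsFrame

theorem isHyperbolicPair (h : IsFrame Q z e f) : IsHyperbolicPair Q e f :=
  ⟨h.e_singular, h.f_singular, h.hyperbolic⟩

theorem apply_combination (h : IsFrame Q z e f) (a b c : F) :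
    Q (a • z + b • e + c • f) = Q z * a ^ 2 + b * c := by
  simp only [QuadraticMap.map_add Q, QuadraticMap.map_smul, polar_add_left, polar_smul_left,
    polar_smul_right, h.e_singular, h.f_singular, h.hyperbolic, h.orth_e, h.orth_f, smul_eq_mul]
  ring

theorem polar_z_combination (h : IsFrame Q z e f) (a b c : F) :
    polar Q z (a • z + b • e + c • f) = 2 * Q z * a := by
  simp only [polar_add_right, polar_smul_right, polar_self_eq_two_mul, h.orth_e, h.orth_f,
    smul_eq_mul]
  ring

theorem polar_e_combination (h : IsFrame Q z e f) (a b c : F) :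
    polar Q e (a • z + b • e + c • f) = c := by
  simp only [polar_add_right, polar_smul_right, polar_comm Q e z, h.orth_e,
    polar_self_eq_zero h.e_singular, h.hyperbolic, smul_eq_mul]
  ring

theorem polar_f_combination (h : IsFrame Q z e f) (a b c : F) :
    polar Q f (a • z + b • e + c • f) = b := by
  simp only [polar_add_right, polar_smul_right, polar_comm Q f z, polar_comm Q f e, h.orth_f,
    polar_self_eq_zero h.f_singular, h.hyperbolic, smul_eq_mul]
  ring

theorem combination_polar_eq_self (h2 : (2 : F) ≠ 0) (h : IsFrame Q z e f)
    (w : frameSpace F z e f) :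
    ((2 * Q z)⁻¹ * polar Q z w) • z + polar Q f w • e + polar Q e w • f = (w : V) := by
  obtain ⟨a, b, c, hw⟩ := exists_eq_combination w
  rw [hw, h.polar_z_combination, h.polar_e_combination, h.polar_f_combination,
    inv_mul_cancel_left₀ (mul_ne_zero h2 h.nonsingular)]

theorem isCompl_perp (h2 : (2 : F) ≠ 0) (h : IsFrame Q z e f) :
    IsCompl (frameSpace F z e f) (perp Q (frameSpace F z e f)) := by
  constructor
  · refine Submodule.disjoint_def.2 fun w hw hperp => ?_
    refine (h.combination_polar_eq_self h2 ⟨w, hw⟩).symm.trans ?_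
    rw [hperp z (mem_frameSpace_left z e f), hperp e (mem_frameSpace_mid z e f),
      hperp f (mem_frameSpace_right z e f), mul_zero, zero_smul, zero_smul, zero_smul, add_zero,
      add_zero]
  · rw [codisjoint_iff, Submodule.eq_top_iff']
    intro v
    set w := ((2 * Q z)⁻¹ * polar Q z v) • z + polar Q f v • e + polar Q e v • f with hw
    have hperp : v - w ∈ perp Q (frameSpace F z e f) := by
      refine mem_perp_span.2 ?_
      rintro s (rfl | rfl | rfl)
      · rw [polar_sub_right, hw, h.polar_z_combination,
          mul_inv_cancel_left₀ (mul_ne_zero h2 h.nonsingular), sub_self]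
      · rw [polar_sub_right, hw, h.polar_e_combination, sub_self]
      · rw [polar_sub_right, hw, h.polar_f_combination, sub_self]
    exact Submodule.mem_sup.2
      ⟨w, Submodule.mem_span_triple.2 ⟨_, _, _, rfl⟩, v - w, hperp, add_sub_cancel _ _⟩

theorem finrank_perp_add_three [FiniteDimensional F V] (h2 : (2 : F) ≠ 0)
    (h : IsFrame Q z e f) :
    Module.finrank F (perp Q (frameSpace F z e f)) + 3 = Module.finrank F V := by
  have hz := finrank_inf_vectorPerp_add_one (X := ⊤) h2 Submodule.mem_top h.nonsingular
  have hef := h.isHyperbolicPair.finrank_inf_vectorPerp (X := ⊤ ⊓ vectorPerp Q z)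
    ⟨Submodule.mem_top, h.orth_e⟩ ⟨Submodule.mem_top, h.orth_f⟩
  rw [finrank_top] at hz
  rw [perp_frameSpace]
  omega

/-- The similitude from `⟨z, e, f⟩` to the traceless matrices that maps `a z + b e + Q(z) c f` to
the matrix with rows `(a, b)` and `(c, -a)`. -/
noncomputable def toTraceless (h2 : (2 : F) ≠ 0) (h : IsFrame Q z e f) :
    frameSpace F z e f ≃ₗ[F] Traceless F where
  toFun w := Traceless.mk ((2 * Q z)⁻¹ * polar Q z w) (polar Q f w) ((Q z)⁻¹ * polar Q e w)
  map_add' u w := by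
    simp only [Submodule.coe_add, polar_add_right, mul_add, Traceless.mk_add_mk]
  map_smul' c w := by
    simp only [Submodule.coe_smul, polar_smul_right, smul_eq_mul, mul_left_comm _ c,
      Traceless.smul_mk, RingHom.id_apply]
  invFun M := ⟨M.1 0 0 • z + M.1 0 1 • e + (Q z * M.1 1 0) • f,
    Submodule.mem_span_triple.2 ⟨_, _, _, rfl⟩⟩
  left_inv w := Subtype.ext <| by
    simpa [Traceless.coe_mk, mul_inv_cancel_left₀ h.nonsingular] using
      h.combination_polar_eq_self h2 w
  right_inv M := by
    obtain ⟨a, b, c, rfl⟩ := Traceless.exists_eq_mk M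
    simp only [h.polar_z_combination, h.polar_e_combination, h.polar_f_combination,
      inv_mul_cancel_left₀ (mul_ne_zero h2 h.nonsingular), inv_mul_cancel_left₀ h.nonsingular]
    rfl

theorem detForm_toTraceless (h2 : (2 : F) ≠ 0) (h : IsFrame Q z e f) (w : frameSpace F z e f) :
    Traceless.detForm F (h.toTraceless h2 w) =
      -(Q z)⁻¹ * restrictForm Q (frameSpace F z e f) w := by
  have hz := h.nonsingular
  obtain ⟨a, b, c, hw⟩ := exists_eq_combination w
  change Traceless.detForm F (Traceless.mk _ _ _) = _ * Q w
  rw [Traceless.detForm_mk, hw, h.polar_z_combination, h.polar_e_combination,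
    h.polar_f_combination, h.apply_combination]
  field_simp

theorem nonempty_groupB_mulEquiv (h2 : (2 : F) ≠ 0) (h : IsFrame Q z e f) :
    Nonempty (groupB Q z e f ≃* omegaGroup (restrictForm Q (frameSpace F z e f))) :=
  nonempty_omegaOn_mulEquiv (h.isCompl_perp h2)

theorem nonempty_groupB_mulEquiv_psl (h2 : (2 : F) ≠ 0) (h : IsFrame Q z e f) :
    Nonempty (groupB Q z e f ≃* Matrix.ProjectiveSpecialLinearGroup (Fin 2) F) := by
  obtain ⟨χ⟩ := h.nonempty_groupB_mulEquiv h2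
  obtain ⟨ψ⟩ := nonempty_omegaGroup_mulEquiv_psl h2 (neg_ne_zero.2 (inv_ne_zero h.nonsingular))
    (h.detForm_toTraceless h2)
  exact ⟨χ.trans ψ⟩

theorem exists_mem_groupB_apply_eq (h2 : (2 : F) ≠ 0) (h : IsFrame Q z e f) (v : V) :
    ∃ b ∈ groupB Q z e f, b.1 v = (reflectionIn Q z h.nonsingular).1 v := by
  have hW := h.isCompl_perp h2
  have hz : restrictForm Q _ ⟨z, mem_frameSpace_left z e f⟩ ≠ 0 := h.nonsingular
  obtain ⟨s, hs, hsv⟩ := exists_mem_omegaGroup_apply_eq h2 hz (h.detForm_toTraceless h2)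
    (Submodule.projectionOnto _ _ hW v)
  refine ⟨extendIsometry hW s, ?_, ?_⟩
  · rw [groupB, ← map_omegaGroup_extendIsometry hW]
    exact Subgroup.mem_map_of_mem _ hs
  · rw [← extendIsometry_reflectionIn hW hz, ← sub_left_inj (a := v), extendIsometry_sub_self,
      extendIsometry_sub_self, hsv]

end IsFrame

end Frame

/-! ### Extending a group by an involution -/

section Orbits

open MulAction

variable {G M : Type*} [Group G] [MulAction G M] {A B : Subgroup G} {τ : G} {m x : M}

/-- `A = B ∪ Bτ` for an involution `τ` that normalises `B`, and no element of the coset `τB` fixes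
a point of `M`; every `A`-orbit on `M` then consists of two `B`-orbits interchanged by `τ`. -/
structure IsSwap (M : Type*) [MulAction G M] (A B : Subgroup G) (τ : G) : Prop where
  le : B ≤ A
  mem : τ ∈ A
  mul_self : τ * τ = 1
  conj_mem : ∀ b ∈ B, τ * b * τ ∈ B
  mem_or : ∀ a ∈ A, a ∈ B ∨ a * τ ∈ B
  smul_ne : ∀ b ∈ B, ∀ m : M, (τ * b) • m ≠ m

/-- The `B`-invariant subsets of `M` that `τ` maps to their complements. -/
def halves (M : Type*) [MulAction G M] (B : Subgroup G) (τ : G) : Set (Set M) :=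
  {H | (∀ b ∈ B, ∀ m : M, b • m ∈ H ↔ m ∈ H) ∧ ∀ m, τ • m ∈ H ↔ m ∉ H}

/-- The chosen representative of the `A`-orbit of `m`. -/
noncomputable def orbitRep (A : Subgroup G) (m : M) : M :=
  (⟦m⟧ : orbitRel.Quotient A M).out

/-- The `A`-orbits whose chosen representative lies in `H`. -/
def representedOrbits (A : Subgroup G) (H : Set M) : Set (orbitRel.Quotient A M) :=
  {o | o.out ∈ H}

/-- The union, over all `A`-orbits `o`, of the part of `o` in the `B`-orbit of its representative
if `o ∈ s`, and of the rest of `o` otherwise. -/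
def halfOf (A B : Subgroup G) (s : Set (orbitRel.Quotient A M)) : Set M :=
  {m | m ∈ orbit B (orbitRep A m) ↔ ⟦m⟧ ∈ s}

theorem orbitRel_mk_smul {a : G} (ha : a ∈ A) (m : M) : (⟦a • m⟧ : orbitRel.Quotient A M) = ⟦m⟧ :=
  Quotient.sound (orbitRel_apply.2 ⟨⟨a, ha⟩, rfl⟩)

theorem orbitRep_smul {a : G} (ha : a ∈ A) (m : M) : orbitRep A (a • m) = orbitRep A m :=
  congrArg Quotient.out (orbitRel_mk_smul ha m)

theorem orbitRep_out (o : orbitRel.Quotient A M) : orbitRep A o.out = o.out :=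
  congrArg Quotient.out o.out_eq

theorem mem_orbit_orbitRep (A : Subgroup G) (m : M) : m ∈ orbit A (orbitRep A m) :=
  orbitRel_apply.1 (Quotient.exact (Quotient.out_eq _).symm)

theorem smul_mem_orbit_iff {b : G} (hb : b ∈ B) : b • x ∈ orbit B m ↔ x ∈ orbit B m := by
  have hx : orbit B (b • x) = orbit B x := orbit_smul (⟨b, hb⟩ : B) x
  rw [← orbit_eq_iff, ← orbit_eq_iff, hx]

theorem orbit_closure_insert_eq (h : ∀ p : M, τ • p ∈ orbit B p) (p : M) :
    orbit (Subgroup.closure (insert τ (B : Set G))) p = orbit B p := by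
  refine Set.Subset.antisymm ?_ ?_
  · rintro _ ⟨⟨a, ha⟩, rfl⟩
    change a • p ∈ orbit B p
    induction ha using Subgroup.closure_induction generalizing p with
    | mem a ha =>
      rcases ha with rfl | ha
      · exact h p
      · exact ⟨⟨a, ha⟩, rfl⟩
    | one => rw [one_smul]; exact mem_orbit_self p
    | mul a c _ _ ha hc =>
      rw [mul_smul, ← orbit_eq_iff, orbit_eq_iff.2 (ha _), orbit_eq_iff.2 (hc _)]
    | inv a _ ha => simpa only [smul_inv_smul] using mem_orbit_symm.1 (ha (a⁻¹ • p))
  · rintro _ ⟨b, rfl⟩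
    exact ⟨⟨b, Subgroup.subset_closure (Set.mem_insert_of_mem _ b.2)⟩, rfl⟩

theorem mem_or_mul_mem_of_mem_closure_insert (hτ : τ * τ = 1) (hconj : ∀ b ∈ B, τ * b * τ ∈ B)
    {a : G} (ha : a ∈ Subgroup.closure (insert τ (B : Set G))) : a ∈ B ∨ a * τ ∈ B := by
  induction ha using Subgroup.closure_induction with
  | mem a ha =>
    rcases ha with rfl | ha
    · exact Or.inr (hτ ▸ one_mem B)
    · exact Or.inl ha
  | one => exact Or.inl (one_mem B)
  | mul a c _ _ ha hc =>
    rcases ha with ha | ha <;> rcases hc with hc | hc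
    · exact Or.inl (mul_mem ha hc)
    · exact Or.inr (mul_assoc a c τ ▸ mul_mem ha hc)
    · have hprod : a * c * τ = a * τ * (τ * c * τ) := by
        rw [mul_assoc τ, ← mul_assoc (a * τ), mul_assoc a τ τ, hτ, mul_one, mul_assoc]
      exact Or.inr (hprod ▸ mul_mem ha (hconj c hc))
    · have hprod : a * c = a * τ * (τ * (c * τ) * τ) := by
        rw [mul_assoc τ, mul_assoc c, hτ, mul_one, ← mul_assoc, mul_assoc a, hτ, mul_one]
      exact Or.inl (hprod ▸ mul_mem ha (hconj _ hc))
  | inv a _ ha =>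
    refine ha.imp inv_mem fun ha => ?_
    have hconj := hconj _ (inv_mem ha)
    rwa [mul_inv_rev, mul_inv_cancel_left] at hconj

theorem representedOrbits_halfOf (A B : Subgroup G) (s : Set (orbitRel.Quotient A M)) :
    representedOrbits A (halfOf A B s) = s := by
  ext o
  rw [representedOrbits, Set.mem_ofPred_eq, halfOf, Set.mem_ofPred_eq, orbitRep_out,
    Quotient.out_eq, iff_true_left (mem_orbit_self _)]

namespace IsSwap

theorem smul_smul_self (h : IsSwap M A B τ) (m : M) : τ • τ • m = m := by
  rw [smul_smul, h.mul_self, one_smul]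

theorem smul_mem_orbit_smul_iff (h : IsSwap M A B τ) :
    τ • x ∈ orbit B (τ • m) ↔ x ∈ orbit B m := by
  have smul_mem {x m : M} (hx : x ∈ orbit B m) : τ • x ∈ orbit B (τ • m) := by
    obtain ⟨b, rfl⟩ := hx
    refine ⟨⟨_, h.conj_mem b b.2⟩, ?_⟩
    change (τ * b * τ) • τ • m = τ • (b : G) • m
    rw [mul_smul, h.smul_smul_self, mul_smul]
  refine ⟨fun hx => ?_, smul_mem⟩
  simpa only [h.smul_smul_self] using smul_mem hx

theorem disjoint_orbit (h : IsSwap M A B τ) (m : M) :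
    Disjoint (orbit B m) (orbit B (τ • m)) := by
  refine Set.disjoint_left.2 fun x hm hτm => ?_
  obtain ⟨b, hb⟩ := orbit_eq_iff.1 ((orbit_eq_iff.2 hτm).symm.trans (orbit_eq_iff.2 hm))
  have hb : (b : G) • m = τ • m := hb
  exact h.smul_ne b b.2 m (by rw [mul_smul, hb, h.smul_smul_self])

theorem orbit_eq_union (h : IsSwap M A B τ) (m : M) :
    orbit A m = orbit B m ∪ orbit B (τ • m) := by
  ext x
  constructor
  · rintro ⟨a, rfl⟩
    rcases h.mem_or a a.2 with ha | ha
    · exact Or.inl ⟨⟨a, ha⟩, rfl⟩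
    · refine Or.inr ⟨⟨_, ha⟩, ?_⟩
      change (a * τ : G) • τ • m = (a : G) • m
      rw [mul_smul, h.smul_smul_self]
  · rintro (⟨b, rfl⟩ | ⟨b, rfl⟩)
    · exact ⟨⟨b, h.le b.2⟩, rfl⟩
    · exact ⟨⟨b * τ, mul_mem (h.le b.2) h.mem⟩, mul_smul _ _ _⟩

theorem smul_mem_orbit_iff_notMem (h : IsSwap M A B τ) (hx : x ∈ orbit A m) :
    τ • x ∈ orbit B m ↔ x ∉ orbit B m := by
  rw [← h.smul_mem_orbit_smul_iff, h.smul_smul_self]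
  rw [h.orbit_eq_union] at hx
  exact ⟨fun hτ hB => Set.disjoint_left.1 (h.disjoint_orbit m) hB hτ, hx.resolve_left⟩

theorem mem_iff_of_mem_halves (h : IsSwap M A B τ) {H H' : Set M} (hH : H ∈ halves M B τ)
    (hH' : H' ∈ halves M B τ) (hm : m ∈ H ↔ m ∈ H') (hx : x ∈ orbit A m) : x ∈ H ↔ x ∈ H' := by
  rw [h.orbit_eq_union] at hx
  rcases hx with ⟨b, rfl⟩ | ⟨b, rfl⟩
  · exact (hH.1 b b.2 m).trans (hm.trans (hH'.1 b b.2 m).symm)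
  · refine (hH.1 b b.2 _).trans (Iff.trans ?_ (hH'.1 b b.2 _).symm)
    rw [hH.2, hH'.2, hm]

theorem injOn_representedOrbits (h : IsSwap M A B τ) :
    Set.InjOn (representedOrbits A) (halves M B τ) := by
  intro H hH H' hH' heq
  ext m
  exact h.mem_iff_of_mem_halves hH hH' (Set.ext_iff.1 heq ⟦m⟧) (mem_orbit_orbitRep A m)

theorem halfOf_mem_halves (h : IsSwap M A B τ) (s : Set (orbitRel.Quotient A M)) :
    halfOf A B s ∈ halves M B τ := by
  refine ⟨fun b hb m => ?_, fun m => ?_⟩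
  · rw [halfOf, Set.mem_ofPred_eq, Set.mem_ofPred_eq, orbitRel_mk_smul (h.le hb),
      orbitRep_smul (h.le hb), smul_mem_orbit_iff hb]
  · rw [halfOf, Set.mem_ofPred_eq, Set.mem_ofPred_eq, orbitRel_mk_smul h.mem, orbitRep_smul h.mem,
      h.smul_mem_orbit_iff_notMem (mem_orbit_orbitRep A m), not_iff]

theorem ncard_halves [Finite (orbitRel.Quotient A M)] (h : IsSwap M A B τ) :
    (halves M B τ).ncard = 2 ^ Nat.card (orbitRel.Quotient A M) := by
  have hbij : Set.BijOn (representedOrbits A) (halves M B τ) Set.univ :=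
    ⟨Set.mapsTo_univ _ _, h.injOn_representedOrbits,
      fun s _ => ⟨halfOf A B s, h.halfOf_mem_halves s, representedOrbits_halfOf A B s⟩⟩
  have := Fintype.ofFinite (orbitRel.Quotient A M)
  rw [← hbij.injOn.ncard_image, hbij.image_eq, Set.ncard_univ, Nat.card_eq_fintype_card,
    Nat.card_eq_fintype_card, Fintype.card_set]

end IsSwap

end Orbits

/-! ### Orbits of `A` and `B` on points and maximals -/

section Groups

open QuadraticMap

variable {F V : Type*} [Field F] [AddCommGroup V] [Module F V] {Q : QuadraticForm F V} {z e f : V}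

namespace QPoint

variable {v : V}

/-- The point of the quadric spanned by a nonzero singular vector. -/
def ofSingular (v : V) (hv0 : v ≠ 0) (hv : Q v = 0) : QPoint Q :=
  ⟨Submodule.span F {v}, fun x hx => by
    obtain ⟨c, rfl⟩ := Submodule.mem_span_singleton.1 hx
    rw [QuadraticMap.map_smul, hv, smul_zero], finrank_span_singleton hv0⟩

theorem exists_eq_ofSingular (p : QPoint Q) :
    ∃ (v : V) (hv0 : v ≠ 0) (hv : Q v = 0), p = ofSingular v hv0 hv := by
  have hp : p.1 ≠ ⊥ := fun hbot => zero_ne_one (α := ℕ) (by rw [← p.2.2, hbot, finrank_bot])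
  obtain ⟨v, hv, hv0⟩ := Submodule.exists_mem_ne_zero_of_ne_bot hp
  have : FiniteDimensional F p.1 := Module.finite_of_finrank_eq_succ p.2.2
  refine ⟨v, hv0, p.2.1 v hv, Subtype.ext (Submodule.eq_of_le_of_finrank_eq ?_ ?_).symm⟩
  · exact (Submodule.span_singleton_le_iff_mem _ _).2 hv
  · exact (finrank_span_singleton hv0).trans p.2.2.symm

theorem smul_ofSingular (g : orthGroup Q) (hv0 : v ≠ 0) (hv : Q v = 0) :
    g • ofSingular v hv0 hv =
      ofSingular (g.1 v) (g.1.map_ne_zero_iff.2 hv0) ((g.2 v).trans hv) :=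
  Subtype.ext <| (Submodule.map_span _ _).trans (by rw [Set.image_singleton]; rfl)

theorem apply_mem_span_of_smul_eq {g : orthGroup Q} {hv0 : v ≠ 0} {hv : Q v = 0}
    (h : g • ofSingular v hv0 hv = ofSingular v hv0 hv) : g.1 v ∈ Submodule.span F {v} := by
  rw [smul_ofSingular] at h
  exact (congrArg Subtype.val h).le (Submodule.mem_span_singleton_self _)

end QPoint

namespace IsFrame

theorem reflectionIn_smul_mem_orbit (h2 : (2 : F) ≠ 0) (h : IsFrame Q z e f) (p : QPoint Q) :
    reflectionIn Q z h.nonsingular • p ∈ MulAction.orbit (groupB Q z e f) p := by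
  obtain ⟨v, hv0, hv, rfl⟩ := p.exists_eq_ofSingular
  obtain ⟨b, hb, hbv⟩ := h.exists_mem_groupB_apply_eq h2 v
  refine ⟨⟨b, hb⟩, ?_⟩
  change b • QPoint.ofSingular v hv0 hv = _
  simp only [QPoint.smul_ofSingular, hbv]

theorem orbit_groupA_eq (h2 : (2 : F) ≠ 0) (h : IsFrame Q z e f) (p : QPoint Q) :
    MulAction.orbit (groupA Q z e f h.nonsingular) p = MulAction.orbit (groupB Q z e f) p :=
  orbit_closure_insert_eq (h.reflectionIn_smul_mem_orbit h2) p

theorem reflectionIn_mul_smul_ne [Finite F] [FiniteDimensional F V] (hF : Odd (Nat.card F))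
    {d : ℕ} (hV : Module.finrank F V = 2 * d + 1) (hQ : IsNondegenerate Q)
    (h : IsFrame Q z e f) {b : orthGroup Q} (hb : b ∈ groupB Q z e f) (m : QMaximal Q) :
    (reflectionIn Q z h.nonsingular * b) • m ≠ m := by
  intro hfix
  have h2 := two_ne_zero_of_odd_card hF
  have hW := h.isCompl_perp h2
  have hz : restrictForm Q _ ⟨z, mem_frameSpace_left z e f⟩ ≠ 0 := h.nonsingular
  have hd : 3 + Module.finrank F (perp Q (frameSpace F z e f)) = 2 * d + 1 := by
    rw [add_comm, h.finrank_perp_add_three h2, hV]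
  have hell := h.elliptic.2
  have hm : Module.finrank F m.1 = d := m.2.2.trans (wittIndex_eq_of_finrank_eq hF hV hQ)
  have hproj := finrank_projectionOnto_add_finrank_inf_perp hW m.1
  have hinf : Module.finrank F ↥(m.1 ⊓ perp Q (frameSpace F z e f)) ≤ _ :=
    finrank_le_wittIndex_restrictForm (m.2.1.mono inf_le_left) inf_le_right
  rw [groupB, ← map_omegaGroup_extendIsometry hW] at hb
  obtain ⟨s, hs, rfl⟩ := hb
  rw [← extendIsometry_reflectionIn hW hz, ← map_mul] at hfix
  obtain ⟨hL, hP, y, hy, hy0, hQy⟩ := exists_singular_of_reflectionIn_mul_sub_mem h2 hz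
    (h.detForm_toTraceless h2) hs (by omega) (comap_subtype_le_map_projectionOnto hW m.1)
    (fun l hl p hp => polar_eq_zero_of_mem_map_projectionOnto hW m.2.1 hl hp)
    (fun p hp => extendIsometry_sub_mem_comap hW (congrArg Subtype.val hfix) hp)
  have hlt := finrank_inf_perp_lt_wittIndex hW m.2.1 hL hy hy0 hQy
  omega

theorem isSwap [Finite F] [FiniteDimensional F V] (hF : Odd (Nat.card F)) {d : ℕ}
    (hV : Module.finrank F V = 2 * d + 1) (hQ : IsNondegenerate Q) (h : IsFrame Q z e f) :
    IsSwap (QMaximal Q) (groupA Q z e f h.nonsingular) (groupB Q z e f)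
      (reflectionIn Q z h.nonsingular) := by
  have hτ := reflectionIn_mul_self h.nonsingular
  have hconj : ∀ b ∈ groupB Q z e f, _ ∈ groupB Q z e f := fun b hb =>
    conj_reflectionIn_mem_omegaOn (h.isCompl_perp (two_ne_zero_of_odd_card hF))
      (mem_frameSpace_left z e f) h.nonsingular hb
  exact
    { le := fun b hb => Subgroup.subset_closure (Set.mem_insert_of_mem _ hb)
      mem := Subgroup.subset_closure (Set.mem_insert _ _)
      mul_self := hτ
      conj_mem := hconj
      mem_or := fun a ha => mem_or_mul_mem_of_mem_closure_insert hτ hconj ha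
      smul_ne := fun b hb m => h.reflectionIn_mul_smul_ne hF hV hQ hb m }

end IsFrame

end Groups

/-! ### Order of the quadric -/

section Order

open QuadraticMap

variable {F V : Type*} [Field F] [AddCommGroup V] [Module F V] {Q : QuadraticForm F V}

theorem exists_polar_ne_zero (hQ : IsNondegenerate Q) {v : V} (hv0 : v ≠ 0) :
    ∃ w, polar Q v w ≠ 0 := by
  by_contra! hv
  exact hv0 (hQ v fun u => by rw [polar_comm, hv])

theorem exists_polar_ne_zero_and (hQ : IsNondegenerate Q) {u v : V} (hu0 : u ≠ 0)
    (hv0 : v ≠ 0) : ∃ w, polar Q u w ≠ 0 ∧ polar Q v w ≠ 0 := by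
  obtain ⟨a, ha⟩ := exists_polar_ne_zero hQ hu0
  obtain ⟨b, hb⟩ := exists_polar_ne_zero hQ hv0
  by_cases hva : polar Q v a = 0
  · by_cases hub : polar Q u b = 0
    · refine ⟨a + b, ?_, ?_⟩
      · rwa [polar_add_right, hub, add_zero]
      · rwa [polar_add_right, hva, zero_add]
    · exact ⟨b, hub, hb⟩
  · exact ⟨a, ha, hva⟩

theorem exists_singular_polar_ne_zero_and (hQ : IsNondegenerate Q) {u v : V} (hu0 : u ≠ 0)
    (hv0 : v ≠ 0) (hu : Q u = 0) (huv : polar Q u v = 0) :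
    ∃ w, Q w = 0 ∧ polar Q u w ≠ 0 ∧ polar Q w v ≠ 0 := by
  obtain ⟨x, hux, hvx⟩ := exists_polar_ne_zero_and hQ hu0 hv0
  refine ⟨x - (Q x / polar Q u x) • u, ?_, ?_, ?_⟩
  · rw [sub_eq_add_neg, ← neg_smul, QuadraticMap.map_add Q, QuadraticMap.map_smul, hu,
      polar_smul_right, polar_comm Q x u, smul_zero, add_zero, smul_eq_mul, neg_mul,
      div_mul_cancel₀ _ hux, add_neg_cancel]
  · rwa [polar_sub_right, polar_smul_right, polar_self_eq_zero hu, smul_zero, sub_zero]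
  · rwa [polar_sub_left, polar_smul_left, huv, smul_zero, sub_zero, polar_comm]

namespace QPoint

theorem exists_smul_ofSingular_eq {u v : V} (hu0 : u ≠ 0) (hu : Q u = 0) (hv0 : v ≠ 0)
    (hv : Q v = 0) (huv : polar Q u v ≠ 0) :
    ∃ g : orthGroup Q, g • ofSingular u hu0 hu = ofSingular v hv0 hv := by
  have hsub : Q (u - v) ≠ 0 := by
    rwa [sub_eq_add_neg, QuadraticMap.map_add Q, QuadraticMap.map_neg, hu, hv, polar_neg_right,
      zero_add, zero_add, neg_ne_zero]
  refine ⟨reflectionIn Q (u - v) hsub, ?_⟩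
  simp only [smul_ofSingular, reflectionIn_sub_apply (hu.trans hv.symm) hsub]

theorem exists_smul_eq (hQ : IsNondegenerate Q) (p q : QPoint Q) :
    ∃ g : orthGroup Q, g • p = q := by
  obtain ⟨u, hu0, hu, rfl⟩ := p.exists_eq_ofSingular
  obtain ⟨v, hv0, hv, rfl⟩ := q.exists_eq_ofSingular
  by_cases huv : polar Q u v = 0
  · obtain ⟨w, hw, huw, hwv⟩ := exists_singular_polar_ne_zero_and hQ hu0 hv0 hu huv
    have hw0 : w ≠ 0 := fun h => huw (h ▸ polar_zero_right Q u)
    obtain ⟨g, hg⟩ := exists_smul_ofSingular_eq hu0 hu hw0 hw huw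
    obtain ⟨k, hk⟩ := exists_smul_ofSingular_eq hw0 hw hv0 hv hwv
    exact ⟨k * g, by rw [mul_smul, hg, hk]⟩
  · exact exists_smul_ofSingular_eq hu0 hu hv0 hv huv

instance finite [Finite V] : Finite (QPoint Q) :=
  inferInstanceAs (Finite (Subtype _))

end QPoint

instance QMaximal.finite [Finite V] : Finite (QMaximal Q) :=
  inferInstanceAs (Finite (Subtype _))

theorem qIncident_smul_iff (g : orthGroup Q) (p : QPoint Q) (m : QMaximal Q) :
    qIncident Q (g • p) (g • m) ↔ qIncident Q p m :=
  Submodule.map_le_map_iff_of_injective (f := (g.1 : V →ₗ[F] V)) g.1.injective p.1 m.1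

theorem card_maximals_smul (g : orthGroup Q) (p : QPoint Q) :
    Nat.card {m // qIncident Q p m} = Nat.card {m // qIncident Q (g • p) m} :=
  Nat.card_congr ((MulAction.toPerm g).subtypeEquiv fun m => (qIncident_smul_iff g p m).symm)

/-- The points on a maximal correspond to its one-dimensional subspaces. -/
def pointsOnEquiv (m : QMaximal Q) :
    {p // qIncident Q p m} ≃ {N : Submodule F m.1 // Module.finrank F N = 1} where
  toFun p := ⟨p.1.1.comap m.1.subtype, by
    rw [← Submodule.finrank_map_subtype_eq, Submodule.map_comap_subtype, inf_eq_right.2 p.2]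
    exact p.1.2.2⟩
  invFun N := ⟨⟨N.1.map m.1.subtype, m.2.1.mono (Submodule.map_subtype_le _ _),
    (Submodule.finrank_map_subtype_eq _ _).trans N.2⟩, Submodule.map_subtype_le _ _⟩
  left_inv p := Subtype.ext <| Subtype.ext <|
    (Submodule.map_comap_subtype _ _).trans (inf_eq_right.2 p.2)
  right_inv N := Subtype.ext (Submodule.comap_map_eq_of_injective m.1.injective_subtype N.1)

theorem card_points_eq [FiniteDimensional F V] (m m' : QMaximal Q) :
    Nat.card {p // qIncident Q p m} = Nat.card {p // qIncident Q p m'} := by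
  rw [Nat.card_congr (pointsOnEquiv m), Nat.card_congr (pointsOnEquiv m')]
  have ψ : m.1 ≃ₗ[F] m'.1 := LinearEquiv.ofFinrankEq _ _ (m.2.2.trans m'.2.2.symm)
  refine Nat.card_congr ((Submodule.orderIsoMapComap ψ).toEquiv.subtypeEquiv fun N => ?_)
  exact (LinearEquiv.finrank_map_eq ψ N).symm ▸ Iff.rfl

theorem QMaximal.exists_qIncident (h : 0 < wittIndex Q) (m : QMaximal Q) :
    ∃ p, qIncident Q p m := by
  have hm : m.1 ≠ ⊥ := fun hbot => h.ne (by rw [← m.2.2, hbot, finrank_bot])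
  obtain ⟨v, hv, hv0⟩ := Submodule.exists_mem_ne_zero_of_ne_bot hm
  exact ⟨.ofSingular v hv0 (m.2.1 v hv), (Submodule.span_singleton_le_iff_mem _ _).2 hv⟩

theorem exists_hasOrder [Finite V] [FiniteDimensional F V] (hQ : IsNondegenerate Q)
    (h : 0 < wittIndex Q) : ∃ s t, HasOrder (qIncident Q) s t := by
  obtain ⟨N, hN, hrank⟩ := exists_finrank_eq_wittIndex Q
  let m₀ : QMaximal Q := ⟨N, hN, hrank⟩
  obtain ⟨p₀, hp₀⟩ := m₀.exists_qIncident h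
  have hs : Nat.card {p // qIncident Q p m₀} ≠ 0 :=
    Nat.card_ne_zero.2 ⟨⟨⟨p₀, hp₀⟩⟩, inferInstance⟩
  have ht : Nat.card {m // qIncident Q p₀ m} ≠ 0 :=
    Nat.card_ne_zero.2 ⟨⟨⟨m₀, hp₀⟩⟩, inferInstance⟩
  obtain ⟨s, hs⟩ := Nat.exists_eq_succ_of_ne_zero hs
  obtain ⟨t, ht⟩ := Nat.exists_eq_succ_of_ne_zero ht
  refine ⟨s, t, fun m => (card_points_eq m m₀).trans hs, fun p => ?_⟩
  obtain ⟨g, rfl⟩ := QPoint.exists_smul_eq hQ p₀ p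
  exact (card_maximals_smul g p₀).symm.trans ht

end Order

/-! ### Hemisystems -/

section Hemisystem

open QuadraticMap

theorem two_mul_card_of_perm {M : Type*} [Finite M] {H : Set M} {I : M → Prop}
    (g : Equiv.Perm M) (hH : ∀ m, g m ∈ H ↔ m ∉ H) (hI : ∀ m, I (g m) ↔ I m) :
    2 * Nat.card {m // m ∈ H ∧ I m} = Nat.card {m // I m} := by
  have hcompl : Nat.card {m // m ∉ H ∧ I m} = Nat.card {m // m ∈ H ∧ I m} :=
    Nat.card_congr (g.subtypeEquiv fun m => by rw [hH, hI])
  have hadd := Set.ncard_inter_add_ncard_sdiff_eq_ncard {m | I m} H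
  rw [Set.inter_comm, Set.sdiff_eq, Set.inter_comm _ Hᶜ] at hadd
  rw [two_mul]
  nth_rewrite 2 [← hcompl]
  exact hadd

variable {F V : Type*} [Field F] [AddCommGroup V] [Module F V] {Q : QuadraticForm F V} {z e f : V}

/-- The action of the orthogonal group on the quadric by automorphisms of the incidence
structure. -/
def orthToAut (Q : QuadraticForm F V) : orthGroup Q →* incidenceAut (qIncident Q) :=
  ((MulAction.toPermHom (orthGroup Q) (QPoint Q)).prod
    (MulAction.toPermHom (orthGroup Q) (QMaximal Q))).codRestrict _
    fun g p m => qIncident_smul_iff g p m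

namespace IsFrame

theorem isHemisystem_of_mem_halves [Finite V] [FiniteDimensional F V] (h2 : (2 : F) ≠ 0)
    (hQ : IsNondegenerate Q) (hpos : 0 < wittIndex Q) (h : IsFrame Q z e f)
    {H : Set (QMaximal Q)}
    (hH : H ∈ halves (QMaximal Q) (groupB Q z e f) (reflectionIn Q z h.nonsingular)) :
    IsHemisystem (qIncident Q) H := by
  obtain ⟨s, t, hst⟩ := exists_hasOrder hQ hpos
  refine ⟨s, t, hst, fun p => ?_⟩
  obtain ⟨⟨b, hb⟩, hbp⟩ := h.reflectionIn_smul_mem_orbit h2 p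
  have hbp : b • p = reflectionIn Q z h.nonsingular • p := hbp
  have hfix : (b⁻¹ * reflectionIn Q z h.nonsingular) • p = p := by
    rw [mul_smul, ← hbp, inv_smul_smul]
  rw [← hst.2 p]
  refine two_mul_card_of_perm (MulAction.toPerm (b⁻¹ * reflectionIn Q z h.nonsingular))
    (fun m => ?_) fun m => ?_
  · rw [MulAction.toPerm_apply, mul_smul, hH.1 _ (inv_mem hb), hH.2]
  · nth_rewrite 1 [← hfix]
    exact qIncident_smul_iff _ p m

theorem exists_mem_perp_ne_zero (h : IsFrame Q z e f) :
    ∃ u ∈ perp Q (frameSpace F z e f), u ≠ 0 := by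
  refine Submodule.exists_mem_ne_zero_of_ne_bot fun hbot => ?_
  have hell := h.elliptic.2
  rw [hbot, finrank_bot] at hell
  omega

theorem eq_one_of_forall_apply_eq (h2 : (2 : F) ≠ 0) (h : IsFrame Q z e f) (c : F)
    {s : orthGroup (restrictForm Q (frameSpace F z e f))}
    (hs : ∀ w, restrictForm Q (frameSpace F z e f) w = c → s.1 w = w) : s = 1 := by
  set z' : frameSpace F z e f := ⟨z, mem_frameSpace_left z e f⟩
  set e' : frameSpace F z e f := ⟨e, mem_frameSpace_mid z e f⟩
  set f' : frameSpace F z e f := ⟨f, mem_frameSpace_right z e f⟩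
  have hval (a : F) := hs (a • z' + (1 : F) • e' + (c - Q z * a ^ 2) • f')
    ((h.apply_combination _ _ _).trans (by ring))
  simp only [map_add, map_smul] at hval
  have hz : s.1 z' = z' := by
    refine smul_right_injective _ h2 ?_
    change (2 : F) • s.1 z' = (2 : F) • z'
    linear_combination (norm := module) hval 1 - hval (-1)
  have hf : s.1 f' = f' := by
    refine smul_right_injective _ h.nonsingular ?_
    change Q z • s.1 f' = Q z • f'
    linear_combination (norm := module) hval 0 - hval 1 + hz
  have he : s.1 e' = e' := by
    linear_combination (norm := module) hval 0 - c • hf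
  refine orthGroup_ext fun w => ?_
  obtain ⟨a, b, c, hw⟩ := exists_eq_combination w
  have hw : w = a • z' + b • e' + c • f' := Subtype.ext hw
  rw [hw, map_add, map_add, map_smul, map_smul, map_smul, hz, he, hf]
  rfl

theorem eq_one_of_smul_eq (h2 : (2 : F) ≠ 0) (h : IsFrame Q z e f) {b : orthGroup Q}
    (hb : b ∈ groupB Q z e f) (hfix : ∀ p : QPoint Q, b • p = p) : b = 1 := by
  have hW := h.isCompl_perp h2
  obtain ⟨u, hu, hu0⟩ := h.exists_mem_perp_ne_zero
  rw [groupB, ← map_omegaGroup_extendIsometry hW] at hb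
  obtain ⟨s, -, rfl⟩ := hb
  suffices hs : s = 1 by rw [hs, map_one]
  refine h.eq_one_of_forall_apply_eq h2 (-Q u) fun w hw => ?_
  have hwu : Q (w + u) = 0 := by
    rw [map_add_of_mem_perp w.2 hu]
    exact hw ▸ neg_add_cancel (Q u)
  have hwu0 : (w + u : V) ≠ 0 := fun hzero => hu0 <|
    Submodule.disjoint_def.1 hW.disjoint u (by
      rw [← neg_eq_of_add_eq_zero_right hzero]; exact neg_mem w.2) hu
  exact apply_eq_self_of_extendIsometry_mem_span hW hu hu0
    (QPoint.apply_mem_span_of_smul_eq (hfix (.ofSingular _ hwu0 hwu)))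

theorem admits (h2 : (2 : F) ≠ 0) (h : IsFrame Q z e f) {H : Set (QMaximal Q)}
    (hH : ∀ g ∈ groupB Q z e f, ∀ m : QMaximal Q, g • m ∈ H ↔ m ∈ H) :
    Admits (qIncident Q) H (groupB Q z e f) := by
  set φ := (orthToAut Q).comp (groupB Q z e f).subtype
  have hφ : Function.Injective φ := by
    refine (injective_iff_map_eq_one φ).2 fun b hb => Subtype.ext ?_
    exact h.eq_one_of_smul_eq h2 b.2 fun p =>
      congrArg (fun k : incidenceAut (qIncident Q) => k.1.1 p) hb
  refine ⟨φ.range, ?_, ⟨MonoidHom.ofInjective hφ⟩⟩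
  rintro _ ⟨b, rfl⟩ m
  exact hH b b.2 m

end IsFrame

end Hemisystem

theorem theorem1 {F V : Type*} [Field F] [Finite F] [AddCommGroup V] [Module F V]
    (hF : Odd (Nat.card F)) (d : ℕ) (hd : 2 ≤ d) (hV : Module.finrank F V = 2 * d + 1)
    (Q : QuadraticForm F V) (hQ : IsNondegenerate Q) :
    (∃ z e f : V, IsFrame Q z e f) ∧
    ∀ (z e f : V) (h : IsFrame Q z e f),
      Nonempty (groupB Q z e f ≃* omegaGroup (restrictForm Q (frameSpace F z e f))) ∧
      Nonempty (groupB Q z e f ≃* Matrix.ProjectiveSpecialLinearGroup (Fin 2) F) ∧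
      (∀ p : QPoint Q, MulAction.orbit (groupA Q z e f h.nonsingular) p =
        MulAction.orbit (groupB Q z e f) p) ∧
      (∀ m : QMaximal Q, ∃ m₁ m₂ : QMaximal Q,
        Disjoint (MulAction.orbit (groupB Q z e f) m₁) (MulAction.orbit (groupB Q z e f) m₂) ∧
        MulAction.orbit (groupA Q z e f h.nonsingular) m =
          MulAction.orbit (groupB Q z e f) m₁ ∪ MulAction.orbit (groupB Q z e f) m₂) ∧
      ∃ 𝓗 : Set (Set (QMaximal Q)),
        𝓗.ncard = 2 ^ Nat.card
          (MulAction.orbitRel.Quotient (groupA Q z e f h.nonsingular) (QMaximal Q)) ∧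
        ∀ H ∈ 𝓗, IsHemisystem (qIncident Q) H ∧
          (∀ g ∈ groupB Q z e f, ∀ m : QMaximal Q, g • m ∈ H ↔ m ∈ H) ∧
          Admits (qIncident Q) H (groupB Q z e f) := by
  have h2 := two_ne_zero_of_odd_card hF
  have : FiniteDimensional F V := Module.finite_of_finrank_eq_succ hV
  have : Finite V := Module.finite_of_finite F
  have hwitt : wittIndex Q = d := wittIndex_eq_of_finrank_eq hF hV hQ
  refine ⟨exists_isFrame hF hd hV hQ, fun z e f h => ?_⟩
  have hswap := h.isSwap hF hV hQ
  have : Finite (MulAction.orbitRel.Quotient (groupA Q z e f h.nonsingular) (QMaximal Q)) :=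
    Quotient.finite _
  exact ⟨h.nonempty_groupB_mulEquiv h2, h.nonempty_groupB_mulEquiv_psl h2, h.orbit_groupA_eq h2,
    fun m => ⟨m, _, hswap.disjoint_orbit m, hswap.orbit_eq_union m⟩,
    halves _ _ _, hswap.ncard_halves, fun H hH =>
      ⟨h.isHemisystem_of_mem_halves h2 hQ (by omega) hH, hH.1, h.admits h2 hH.1⟩⟩
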